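/- **Setting.** Let $x$ range over a periodic planar domain, $\Omega=(\sqrt{1-\mu^2}\cos\theta,\sqrt{1-\mu^2}\sin\theta,\mu)\in\mathbb S^2$, and consider the macro-micro system ($f=\rho+\epsilon g$, $\rho=\langle f\rangle$) $$\partial_t\rho+\nabla_x\cdot\langle\Omega g\rangle=-\sigma_a\rho+Q,\qquad \partial_t g+\tfrac1\epsilon(I-\Pi)\nabla_x\cdot(\Omega g)+\tfrac1{\epsilon^2}\nabla_x\cdot(\Omega\rho)=-\tfrac{\sigma_s}{\epsilon^2}g-\sigma_a g,$$ with $\sigma_s>0$, $\sigma_a\ge0$, $(I-\Pi)\nabla_x\cdot(\Omega g)=\nabla_x\cdot(\Omega g)-\nabla_x\cdot\langle\Omega g\rangle$. All functions are sampled on a fixed mesh of $N_x$ spatial nodes and $N_\theta\times N_\mu$ directions. The discretizations are exact in the following sense: $\nabla_x$ of nodal values is the exact gradient, at the nodes, of the unique function with these nodal values in a fixed space of periodic $C^1$ functions; $\langle\cdot\rangle$ is a quadrature on the grid of directions that reproduces the mean over $\mathbb S^2$ of every polynomial of degree at most $2$ in $\Omega$. $\|\cdot\|$ is the Frobenius (Euclidean)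 norm of nodal values. **Scheme.** Take $\Delta t>0$ and an $s$-stage globally stiffly accurate IMEX Runge-Kutta scheme with strictly lower triangular explicit matrix $(\tilde a_{\ell j})$ and lower triangular implicit matrix $(a_{\ell j})$, $a_{\ell\ell}\neq0$ for $\ell\ge2$. Let $\bar\epsilon>0$ be such that $\epsilon^2+a_{\ell\ell}\Delta t\,\sigma_s\ne0$ for all $\ell$, all nodes and all $0<\epsilon\le\bar\epsilon$. For given starting values $\rho^n,g^n$, sources $Q^{(j)}$ independent of $\epsilon$, and earlier microscopic tensors $h^{(j)}$, stage $\ell$ is $$\rho^{(\ell)}=\rho^n+\Delta t\sum_{j<\ell}\tilde a_{\ell j}\big(-\nabla_x\cdot\langle\Omega h^{(j)}\rangle-\sigma_a\rho^{(j)}+Q^{(j)}\big),$$ $$g^{(\ell)}=g^n-\tfrac{\Delta t}{\epsilon}\sum_{j<\ell}\tilde a_{\ell j}(I-\Pi)\nabla_x\cdot(\Omega h^{(j)})-\Delta t\sum_{j<\ell}\tilde a_{\ell j}\sigma_a h^{(j)}-\tfrac{\Delta t}{\epsilon^2}\Big(\sum_{j<\ell}a_{\ell j}\big(\nabla_x\cdot(\Omega\rho^{(j)})+\sigma_s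 h^{(j)}\big)+a_{\ell\ell}\big(\nabla_x\cdot(\Omega\rho^{(\ell)})+\sigma_s g^{(\ell)}\big)\Big).$$ The *full-grid scheme* ($h^{(j)}=g^{(j)}$) gives $\rho^{(\ell)},g^{(\ell)}$. The *low-rank scheme*, from the same starting values, gives densities $\tilde\rho^{(\ell)}$, which are not truncated, and microscopic tensors $\tilde g^{(\ell)}$; there $h^{(j)}=\mathcal T_j\tilde g^{(j)}$ is the truncation of $\tilde g^{(j)}$ by the hierarchical (root-to-leaves) HOSVD, with arbitrary hierarchical ranks $r^{(j)}_t$, to the hierarchical Tucker format on the unsplit tree $\mathcal T$ with root $\{x,y,\theta,\mu\}$, children $\{x,y\}$ and $\{\theta,\mu\}$, and leaves $\{x,y\},\{\theta\},\{\mu\}$. Let $\sigma^{(j)}_{t,r_t+1}$ be the largest singular value of the mode-$t$ matricization of $\tilde g^{(j)}$ that this truncation removes. **Data.** The starting values are $\rho^n=\langle f^\epsilon\rangle$, $g^n=(f^\epsilon-\langle f^\epsilon\rangle)/\epsilon$ with well-prepared $f^\epsilon$: there are $f_0,f_1$ with $\sigma_s(\langle f_0\rangle-f_0)=0$, $\Omega\cdot\nabla_xf_0=\sigma_s(\langle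 f_1\rangle-f_1)$ and $\|f^\epsilon-f_0-\epsilon f_1\|\le K\epsilon^2$ for $0<\epsilon\le\bar\epsilon$. Moreover, $\nabla_xg^n$ is bounded uniformly in $0<\epsilon\le\bar\epsilon$. **Lemma.** There is a constant $C$, independent of $\epsilon$, of the ranks $r_t^{(j)}$ and of the choice of singular vectors, such that for all $0<\epsilon\le\bar\epsilon$ and all stages $\ell=1,\dots,s$ $$\Big\|-\frac1{3\sigma_s}\nabla_x\rho^{(\ell)}-\langle\Omega\tilde g^{(\ell)}\rangle\Big\|\le C\Big(\epsilon+(2+\epsilon)\max_{1\le j<\ell,\ t\in\mathcal T}\sigma^{(j)}_{t,r_t+1}\Big),$$ where the maximum over the empty set is $0$. If $\tilde g^{(\ell)}$ is replaced by its truncation $\mathcal T_\ell\tilde g^{(\ell)}$, the same holds with the maximum over $1\le j\le\ell$. Both bounds also hold with $\tilde\rho^{(\ell)}$ in place of $\rho^{(\ell)}$. -/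

import Mathlib

noncomputable section

namespace TransportHTT

open scoped BigOperators

/-! ### Spatial and angular discretizations -/

/-- A nodal function of space. -/
abbrev NodalFun (Nx : ℕ) : Type := Fin Nx → ℝ

/-- A function of `(x, y, θ, μ)` sampled on the mesh.  Space is a single mode of size `Nx`
(unsplit), the two angular variables are the modes of size `Nθ` and `Nμ`. -/
abbrev PhaseTensor (Nx Nθ Nμ : ℕ) : Type := Fin Nx → Fin Nθ → Fin Nμ → ℝ

/-- A periodic spatial mesh in the plane with a space of smooth periodic functions that are
determined by their nodal values.  The numerical gradient (`SpatialDiscretization.partialD` below)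
is the exact gradient on this space. -/
structure SpatialDiscretization (Nx : ℕ) where
  periodX : ℝ
  periodY : ℝ
  periodX_pos : 0 < periodX
  periodY_pos : 0 < periodY
  node : Fin Nx → ℝ × ℝ
  trial : Submodule ℝ (ℝ × ℝ → ℝ)
  contDiff_trial : ∀ u ∈ trial, ContDiff ℝ 1 u
  periodic_trial : ∀ u ∈ trial, ∀ x y : ℝ,
    u (x + periodX, y) = u (x, y) ∧ u (x, y + periodY) = u (x, y)
  unisolvent : Function.Bijective fun (u : trial) (i : Fin Nx) => (u : ℝ × ℝ → ℝ) (node i)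

/-- The unique trial function with the nodal values `v`. -/
def SpatialDiscretization.interpolant {Nx : ℕ} (S : SpatialDiscretization Nx) (v : NodalFun Nx) :
    ℝ × ℝ → ℝ :=
  ((Equiv.ofBijective _ S.unisolvent).symm v : S.trial)

/-- The components `∂_x, ∂_y, ∂_z` of the gradient, at the nodes.  The position varies in the
plane only, so that `∂_z = 0`. -/
def SpatialDiscretization.partialD {Nx : ℕ} (S : SpatialDiscretization Nx) (d : Fin 3)
    (v : NodalFun Nx) : NodalFun Nx := fun i =>
  fderiv ℝ (S.interpolant v) (S.node i) ((![(1, 0), (0, 1), (0, 0)] : Fin 3 → ℝ × ℝ) d)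

/-- The unit vector `Ω = (√(1 - μ²) cos θ, √(1 - μ²) sin θ, μ)`. -/
def direction (θ μ : ℝ) : Fin 3 → ℝ :=
  ![Real.sqrt (1 - μ ^ 2) * Real.cos θ, Real.sqrt (1 - μ ^ 2) * Real.sin θ, μ]

/-- A quadrature on a tensor grid of directions, exact for the quadratic polynomials on the
sphere.  (The Chebyshev-Legendre rules of order at least two are examples.) -/
structure AngularDiscretization (Nθ Nμ : ℕ) where
  theta : Fin Nθ → ℝ
  mu : Fin Nμ → ℝ
  weight : Fin Nθ → Fin Nμ → ℝ
  theta_mem : ∀ k, theta k ∈ Set.Ico 0 (2 * Real.pi)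
  mu_mem : ∀ l, mu l ∈ Set.Icc (-1 : ℝ) 1
  exact_quadratic : ∀ p : MvPolynomial (Fin 3) ℝ, p.totalDegree ≤ 2 →
    (1 / (4 * Real.pi)) * ∑ k, ∑ l, weight k l * MvPolynomial.eval (direction (theta k) (mu l)) p
      = (1 / (4 * Real.pi)) *
        ∫ φ in (0 : ℝ)..(2 * Real.pi), ∫ m in (-1 : ℝ)..1, MvPolynomial.eval (direction φ m) p

variable {Nx Nθ Nμ s : ℕ}

/-- The discrete direction `Ω_{k,l}`. -/
def AngularDiscretization.Om (𝒜 : AngularDiscretization Nθ Nμ) (k : Fin Nθ) (l : Fin Nμ) :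
    Fin 3 → ℝ :=
  direction (𝒜.theta k) (𝒜.mu l)

/-- The angular average `⟨g⟩`. -/
def AngularDiscretization.avg (𝒜 : AngularDiscretization Nθ Nμ) (g : PhaseTensor Nx Nθ Nμ) :
    NodalFun Nx := fun i =>
  (1 / (4 * Real.pi)) * ∑ k, ∑ l, 𝒜.weight k l * g i k l

/-- The components of the flux `⟨Ω g⟩`. -/
def AngularDiscretization.flux (𝒜 : AngularDiscretization Nθ Nμ) (g : PhaseTensor Nx Nθ Nμ)
    (d : Fin 3) : NodalFun Nx :=
  𝒜.avg fun i k l => 𝒜.Om k l d * g i k l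

/-- `∇ₓ · ⟨Ω g⟩`. -/
def divFlux (S : SpatialDiscretization Nx) (𝒜 : AngularDiscretization Nθ Nμ)
    (g : PhaseTensor Nx Nθ Nμ) : NodalFun Nx := fun i =>
  ∑ d, S.partialD d (𝒜.flux g d) i

/-- The components of `∇ₓ g`, computed for each direction separately. -/
def gradTensor (S : SpatialDiscretization Nx) (d : Fin 3) (g : PhaseTensor Nx Nθ Nμ) :
    PhaseTensor Nx Nθ Nμ := fun i k l =>
  S.partialD d (fun i' => g i' k l) i

/-- `∇ₓ · (Ω g)`. -/
def transport (S : SpatialDiscretization Nx) (𝒜 : AngularDiscretization Nθ Nμ)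
    (g : PhaseTensor Nx Nθ Nμ) : PhaseTensor Nx Nθ Nμ := fun i k l =>
  ∑ d, 𝒜.Om k l d * gradTensor S d g i k l

/-- `∇ₓ · (Ω ρ) = Ω · ∇ₓ ρ`. -/
def transportScalar (S : SpatialDiscretization Nx) (𝒜 : AngularDiscretization Nθ Nμ)
    (ρ : NodalFun Nx) : PhaseTensor Nx Nθ Nμ := fun i k l =>
  ∑ d, 𝒜.Om k l d * S.partialD d ρ i

/-- `(I - Π) (∇ₓ · (Ω g)) = ∇ₓ · (Ω g) - ∇ₓ · ⟨Ω g⟩`. -/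
def microTransport (S : SpatialDiscretization Nx) (𝒜 : AngularDiscretization Nθ Nμ)
    (g : PhaseTensor Nx Nθ Nμ) : PhaseTensor Nx Nθ Nμ := fun i k l =>
  transport S 𝒜 g i k l - divFlux S 𝒜 g i

/-- Frobenius norm. -/
def frobNorm (g : PhaseTensor Nx Nθ Nμ) : ℝ :=
  Real.sqrt (∑ i, ∑ k, ∑ l, g i k l ^ 2)

/-- Frobenius norm of `∇ₓ g`. -/
def gradNorm (S : SpatialDiscretization Nx) (g : PhaseTensor Nx Nθ Nμ) : ℝ :=
  Real.sqrt (∑ d, frobNorm (gradTensor S d g) ^ 2)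

/-- `‖ -(1 / (3 σ_s)) ∇ₓ ρ - ⟨Ω g⟩ ‖`. -/
def fluxDefect (S : SpatialDiscretization Nx) (𝒜 : AngularDiscretization Nθ Nμ)
    (σs : NodalFun Nx) (ρ : NodalFun Nx) (g : PhaseTensor Nx Nθ Nμ) : ℝ :=
  Real.sqrt (∑ i, ∑ d, (-(1 / (3 * σs i)) * S.partialD d ρ i - 𝒜.flux g d i) ^ 2)

/-! ### Macro-micro decomposition and well-prepared data -/

/-- The density `ρ = ⟨f⟩`. -/
def macroPart (𝒜 : AngularDiscretization Nθ Nμ) (f : PhaseTensor Nx Nθ Nμ) : NodalFun Nx :=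
  𝒜.avg f

/-- The microscopic part `g = (f - ⟨f⟩) / ε` in `f = ρ + ε g`. -/
def microPart (𝒜 : AngularDiscretization Nθ Nμ) (ε : ℝ) (f : PhaseTensor Nx Nθ Nμ) :
    PhaseTensor Nx Nθ Nμ := fun i k l =>
  (f i k l - 𝒜.avg f i) / ε

/-- Well-prepared data: `f^ε = f₀ + ε f₁ + O(ε²)`, where `f₀` and `f₁` satisfy the equations of
order `ε⁻²` and `ε⁻¹` of the formal (Chapman-Enskog) expansion of the transport equation,
`σ_s (⟨f₀⟩ - f₀) = 0` and `Ω · ∇ₓ f₀ = σ_s (⟨f₁⟩ - f₁)`.  Data with a consistent expansion to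
higher or to all orders satisfy this as well. -/
def WellPrepared (S : SpatialDiscretization Nx) (𝒜 : AngularDiscretization Nθ Nμ)
    (σs : NodalFun Nx) (εmax : ℝ) (f : ℝ → PhaseTensor Nx Nθ Nμ) : Prop :=
  ∃ f₀ f₁ : PhaseTensor Nx Nθ Nμ,
    (∀ i k l, σs i * (𝒜.avg f₀ i - f₀ i k l) = 0) ∧
    (∀ i k l, transport S 𝒜 f₀ i k l = σs i * (𝒜.avg f₁ i - f₁ i k l)) ∧
    ∃ K : ℝ, ∀ ε, 0 < ε → ε ≤ εmax →
      frobNorm (fun i k l => f ε i k l - (f₀ i k l + ε * f₁ i k l)) ≤ K * ε ^ 2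

/-! ### Globally stiffly accurate IMEX Runge-Kutta schemes -/

/-- The two Butcher tableaux of an `s`-stage globally stiffly accurate IMEX scheme.  All diagonal
entries of the implicit matrix but the first are required to be nonzero; this covers the
schemes with an invertible implicit matrix and those whose first stage is explicit. -/
structure IMEXTableau (s : ℕ) where
  /-- explicit matrix -/
  Aex : Matrix (Fin s) (Fin s) ℝ
  /-- explicit weights -/
  bex : Fin s → ℝ
  /-- implicit matrix -/
  Aim : Matrix (Fin s) (Fin s) ℝ
  /-- implicit weights -/
  bim : Fin s → ℝ
  explicit : ∀ i j, i ≤ j → Aex i j = 0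
  lower : ∀ i j, i < j → Aim i j = 0
  diag_ne_zero : ∀ i : Fin s, 0 < (i : ℕ) → Aim i i ≠ 0
  stiffly_accurate : ∀ i : Fin s, (i : ℕ) + 1 = s → ∀ j, Aim i j = bim j ∧ Aex i j = bex j

/-- The stage equations of the IMEX scheme for the macro-micro system, started from `(ρn, gn)`.
Stage `ℓ` produces `ρ ℓ` and `g ℓ` from the earlier densities `ρ j` and the earlier microscopic
tensors `h j`, `j < ℓ`.  For the full-grid scheme `h = g`; for the low-rank scheme `h j` is the
truncation of `g j`. -/
def StageEquations (S : SpatialDiscretization Nx) (𝒜 : AngularDiscretization Nθ Nμ)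
    (tab : IMEXTableau s) (σs σa : NodalFun Nx) (Q : Fin s → NodalFun Nx) (Δt ε : ℝ)
    (ρn : NodalFun Nx) (gn : PhaseTensor Nx Nθ Nμ) (h : Fin s → PhaseTensor Nx Nθ Nμ)
    (ρ : Fin s → NodalFun Nx) (g : Fin s → PhaseTensor Nx Nθ Nμ) : Prop :=
  ∀ ℓ : Fin s,
    (∀ i, ρ ℓ i = ρn i + Δt * ∑ j ∈ Finset.Iio ℓ,
      tab.Aex ℓ j * (-divFlux S 𝒜 (h j) i - σa i * ρ j i + Q j i)) ∧
    (∀ i k l, g ℓ i k l = gn i k l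
      - Δt / ε * ∑ j ∈ Finset.Iio ℓ, tab.Aex ℓ j * microTransport S 𝒜 (h j) i k l
      - Δt * ∑ j ∈ Finset.Iio ℓ, tab.Aex ℓ j * (σa i * h j i k l)
      - Δt / ε ^ 2 *
        (∑ j ∈ Finset.Iio ℓ,
            tab.Aim ℓ j * (transportScalar S 𝒜 (ρ j) i k l + σs i * h j i k l)
          + tab.Aim ℓ ℓ * (transportScalar S 𝒜 (ρ ℓ) i k l + σs i * g ℓ i k l)))

/-! ### Hierarchical Tucker format on the unsplit tree and its HOSVD truncation -/

/-- The nodes below the root of the unsplit dimension tree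
`{x,y,θ,μ} → {x,y}, {θ,μ}` and `{θ,μ} → {θ}, {μ}`.  The matricization at the root has a single
column, so nothing is discarded there. -/
inductive TreeNode
  | space
  | angle
  | theta
  | mu

/-- Matricization: the modes of the node index the rows, the other modes the columns. -/
def matSpace (A : PhaseTensor Nx Nθ Nμ) : Matrix (Fin Nx) (Fin Nθ × Fin Nμ) ℝ :=
  fun i q => A i q.1 q.2

/-- Matricization: the modes of the node index the rows. -/
def matAngle (A : PhaseTensor Nx Nθ Nμ) : Matrix (Fin Nθ × Fin Nμ) (Fin Nx) ℝ :=
  fun q i => A i q.1 q.2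

/-- Matricization: the modes of the node index the rows. -/
def matTheta (A : PhaseTensor Nx Nθ Nμ) : Matrix (Fin Nθ) (Fin Nx × Fin Nμ) ℝ :=
  fun k q => A q.1 k q.2

/-- Matricization: the modes of the node index the rows. -/
def matMu (A : PhaseTensor Nx Nθ Nμ) : Matrix (Fin Nμ) (Fin Nx × Fin Nθ) ℝ :=
  fun l q => A q.1 q.2 l

/-- The singular values of a matrix in decreasing order, indexed from `0` and continued by `0`. -/
def singVal {m n : Type*} [Fintype m] [Fintype n] [DecidableEq n] (M : Matrix m n ℝ) (i : ℕ) : ℝ :=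
  (Matrix.toEuclideanLin M).singularValues i

/-- The columns `U 0, …, U (r - 1)` are leading left singular vectors of `M`: the first `r`
members of an orthonormal basis of left singular vectors ordered by decreasing singular value. -/
def IsLeadingLeftSingular {m n : Type*} [Fintype m] [Fintype n] [DecidableEq n]
    (M : Matrix m n ℝ) (r : ℕ) (U : Fin r → m → ℝ) : Prop :=
  ∃ (hr : r ≤ Fintype.card m)
    (u : OrthonormalBasis (Fin (Fintype.card m)) ℝ (EuclideanSpace ℝ m)),
    (∀ a, (M * M.transpose).mulVec (u a) = fun q => singVal M a ^ 2 * u a q) ∧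
    ∀ a q, U a q = u (Fin.castLE hr a) q

/-- Hierarchical ranks. -/
abbrev HTTRanks : Type := TreeNode → ℕ

/-- A tensor in the hierarchical Tucker format on the unsplit tree. -/
structure HTT (Nx Nθ Nμ : ℕ) (r : HTTRanks) where
  Uspace : Fin (r .space) → Fin Nx → ℝ
  Utheta : Fin (r .theta) → Fin Nθ → ℝ
  Umu : Fin (r .mu) → Fin Nμ → ℝ
  Bangle : Fin (r .theta) → Fin (r .mu) → Fin (r .angle) → ℝ
  Broot : Fin (r .space) → Fin (r .angle) → ℝ

/-- The basis at the node `{θ, μ}`. -/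
def HTT.Uangle {r : HTTRanks} (T : HTT Nx Nθ Nμ r) (c : Fin (r .angle)) (k : Fin Nθ)
    (l : Fin Nμ) : ℝ :=
  ∑ a, ∑ b, T.Bangle a b c * (T.Utheta a k * T.Umu b l)

/-- The tensor that is represented. -/
def HTT.toTensor {r : HTTRanks} (T : HTT Nx Nθ Nμ r) : PhaseTensor Nx Nθ Nμ := fun i k l =>
  ∑ a, ∑ c, T.Broot a c * (T.Uspace a i * T.Uangle c k l)

/-- `B` is the HOSVD truncation of `A` to the hierarchical ranks `r` (from the root to the leaves):
the bases are spanned by leading left singular vectors of the matricizations of `A`, and the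
transfer tensors are the coefficients of the orthogonal projections.  Equivalently, `A` is
projected at the nodes `{x,y}` and `{θ,μ}` and then at `{θ}` and `{μ}`. -/
def IsHOSVDTruncation (r : HTTRanks) (A B : PhaseTensor Nx Nθ Nμ) : Prop :=
  ∃ (T : HTT Nx Nθ Nμ r) (V : Fin (r .angle) → Fin Nθ × Fin Nμ → ℝ),
    IsLeadingLeftSingular (matSpace A) (r .space) T.Uspace ∧
    IsLeadingLeftSingular (matAngle A) (r .angle) V ∧
    IsLeadingLeftSingular (matTheta A) (r .theta) T.Utheta ∧
    IsLeadingLeftSingular (matMu A) (r .mu) T.Umu ∧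
    (∀ a b c, T.Bangle a b c = ∑ k, ∑ l, T.Utheta a k * T.Umu b l * V c (k, l)) ∧
    (∀ a c, T.Broot a c = ∑ i, ∑ k, ∑ l, T.Uspace a i * V c (k, l) * A i k l) ∧
    B = T.toTensor

/-- `σ_{t, r_t + 1}`, the largest singular value of the matricization of `A` at the node `t` that
is removed by a truncation to the ranks `r`. -/
def discarded (r : HTTRanks) (A : PhaseTensor Nx Nθ Nμ) : TreeNode → ℝ
  | .space => singVal (matSpace A) (r .space)
  | .angle => singVal (matAngle A) (r .angle)
  | .theta => singVal (matTheta A) (r .theta)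
  | .mu => singVal (matMu A) (r .mu)

/-- The maximum of `σ^{(j)}_{t, r_t + 1}` over the stages `j ∈ J` and the nodes `t`; it is `0` if
`J` is empty. -/
def maxDiscarded (r : Fin s → HTTRanks) (g : Fin s → PhaseTensor Nx Nθ Nμ)
    (J : Finset (Fin s)) : ℝ :=
  ⨆ p : {j // j ∈ J} × TreeNode, discarded (r p.1) (g p.1) p.2

end TransportHTT

end

open TransportHTT

/-!
In the diffusion limit the microscopic tensor that belongs to a density `ρ` is the equilibrium
`G ρ = -(1 / σ_s) Ω · ∇ₓ ρ`.  Since the quadrature reproduces the second moments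
`⟨Ω_a Ω_b⟩ = δ_ab / 3`, its flux is `⟨Ω G ρ⟩ = -(1 / (3 σ_s)) ∇ₓ ρ`, so that the
flux defect of `(ρ, g)` is the norm of the flux of `G ρ - g` (`fluxDefect_eq`).  It remains to bound `g - G ρ`.

Well-prepared data have deviation `g - G ρ = O(ε)` (`WellPrepared.isBigO_data`).  Multiplied by
`ε²`, a stage reads
`(ε² + a_ℓℓ Δt σ_s) (g_ℓ - G ρ_ℓ) = O(ε) - Δt σ_s ∑_{j < ℓ} a_ℓj (h_j - G ρ_j)`
(`StageEquations.deviation_eq`), and the factor on the left is bounded away from zero up to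
and including `ε = 0` unless `a_ℓℓ = 0`, which happens at most in the first stage.  A stage
thus passes on the deviations of the tensors `h_j` that enter it, and these differ from `g_j` by the truncation only.  Induction on the stages bounds every stage
and its deviation (`StageEquations.isBigO_stages`), and a second induction compares the densities
of the two schemes (`StageEquations.isBigO_density_sub`).

The hierarchical truncation is a product of four projections (`HTT.toTensor_eq_act`).  Each of
them moves the tensor by at most a multiple of the first singular value that it discards, and all
are bounded independently of the ranks, so that the errors add up
(`IsHOSVDTruncation.norm_sub_le`).

Uniformity of the constants is expressed by `=O[⊤]` over the type of all admissible runs: such a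
bound is one constant for all `ε`, ranks and singular vectors.  Norms of nodal functions and
tensors in these bounds are maximum norms; the dimensions are fixed.
-/

namespace TransportHTT

open scoped BigOperators
open Asymptotics

variable {Nx Nθ Nμ s : ℕ}

/-! ### Linearity of the discrete operators -/

/-- Linear maps on finite-dimensional spaces are bounded. -/
theorem isBigO_of_isLinearMap {X E F G : Type*} [NormedAddCommGroup E] [NormedSpace ℝ E]
    [FiniteDimensional ℝ E] [NormedAddCommGroup F] [NormedSpace ℝ F] [Norm G] {L : E → F}
    (hL : IsLinearMap ℝ L) {l : Filter X} {v : X → E} {w : X → G} (h : v =O[l] w) :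
    (fun x => L (v x)) =O[l] w :=
  ((LinearMap.toContinuousLinearMap (IsLinearMap.mk' L hL)).isBigO_comp v l).trans h

/-- Interpolation is the inverse of the linear bijection that samples a trial function. -/
theorem isLinearMap_interpolant (S : SpatialDiscretization Nx) : IsLinearMap ℝ S.interpolant := by
  let E : S.trial →ₗ[ℝ] NodalFun Nx :=
    { toFun := fun u i => (u : ℝ × ℝ → ℝ) (S.node i)
      map_add' := fun u v => rfl
      map_smul' := fun c u => rfl }
  let e := LinearEquiv.ofBijective E S.unisolvent
  have h : ∀ v, S.interpolant v = (e.symm v : S.trial) := by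
    intro v
    have : (Equiv.ofBijective _ S.unisolvent).symm v = e.symm v := by
      rw [Equiv.symm_apply_eq]
      exact (e.apply_symm_apply v).symm
    exact congrArg Subtype.val this
  constructor
  · intro v w
    simp [h]
  · intro c v
    simp [h]

theorem isLinearMap_partialD (S : SpatialDiscretization Nx) (d : Fin 3) :
    IsLinearMap ℝ (S.partialD d) := by
  have hd : ∀ v p, DifferentiableAt ℝ (S.interpolant v) p := fun v p =>
    ((S.contDiff_trial _ (Subtype.property _)).differentiable one_ne_zero) p
  constructor
  · intro v w
    ext i
    simp only [SpatialDiscretization.partialD, (isLinearMap_interpolant S).map_add, Pi.add_apply]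
    rw [fderiv_add (hd v _) (hd w _)]
    rfl
  · intro c v
    ext i
    simp only [SpatialDiscretization.partialD, (isLinearMap_interpolant S).map_smul, Pi.smul_apply]
    rw [fderiv_const_smul (hd v _)]
    rfl

theorem isLinearMap_avg (𝒜 : AngularDiscretization Nθ Nμ) :
    IsLinearMap ℝ (𝒜.avg : PhaseTensor Nx Nθ Nμ → NodalFun Nx) := by
  constructor
  · intro v w
    ext i
    simp [AngularDiscretization.avg, mul_add, Finset.sum_add_distrib]
  · intro c v
    ext i
    simp only [AngularDiscretization.avg, Pi.smul_apply, smul_eq_mul, Finset.mul_sum]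
    exact Finset.sum_congr rfl fun k _ => Finset.sum_congr rfl fun l _ => by ring

theorem isLinearMap_flux (𝒜 : AngularDiscretization Nθ Nμ) (d : Fin 3) :
    IsLinearMap ℝ (fun g : PhaseTensor Nx Nθ Nμ => 𝒜.flux g d) := by
  constructor
  · intro v w
    simp only [AngularDiscretization.flux]
    rw [← (isLinearMap_avg 𝒜).map_add]
    congr 1
    ext i k l
    simp [mul_add]
  · intro c v
    simp only [AngularDiscretization.flux]
    rw [← (isLinearMap_avg 𝒜).map_smul]
    congr 1
    ext i k l
    simp only [Pi.smul_apply, smul_eq_mul]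
    ring

theorem isLinearMap_divFlux (S : SpatialDiscretization Nx) (𝒜 : AngularDiscretization Nθ Nμ) :
    IsLinearMap ℝ (divFlux S 𝒜) := by
  constructor
  · intro v w
    ext i
    simp [divFlux, (isLinearMap_flux 𝒜 _).map_add, (isLinearMap_partialD S _).map_add,
      Finset.sum_add_distrib]
  · intro c v
    ext i
    simp [divFlux, (isLinearMap_flux 𝒜 _).map_smul, (isLinearMap_partialD S _).map_smul,
      Finset.mul_sum]

theorem isLinearMap_gradTensor (S : SpatialDiscretization Nx) (d : Fin 3) :
    IsLinearMap ℝ (gradTensor S d : PhaseTensor Nx Nθ Nμ → PhaseTensor Nx Nθ Nμ) := by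
  constructor
  · intro v w
    ext i k l
    exact congrFun ((isLinearMap_partialD S d).map_add (fun i => v i k l) fun i => w i k l) i
  · intro c v
    ext i k l
    exact congrFun ((isLinearMap_partialD S d).map_smul c fun i => v i k l) i

theorem isLinearMap_transport (S : SpatialDiscretization Nx) (𝒜 : AngularDiscretization Nθ Nμ) :
    IsLinearMap ℝ (transport S 𝒜) := by
  constructor
  · intro v w
    ext i k l
    simp [transport, (isLinearMap_gradTensor S _).map_add, mul_add, Finset.sum_add_distrib]
  · intro c v
    ext i k l
    simp only [transport, (isLinearMap_gradTensor S _).map_smul, Pi.smul_apply, smul_eq_mul,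
      Finset.mul_sum]
    exact Finset.sum_congr rfl fun d _ => by ring

theorem isLinearMap_transportScalar (S : SpatialDiscretization Nx)
    (𝒜 : AngularDiscretization Nθ Nμ) : IsLinearMap ℝ (transportScalar S 𝒜) := by
  constructor
  · intro v w
    ext i k l
    simp [transportScalar, (isLinearMap_partialD S _).map_add, mul_add, Finset.sum_add_distrib]
  · intro c v
    ext i k l
    simp only [transportScalar, (isLinearMap_partialD S _).map_smul, Pi.smul_apply, smul_eq_mul,
      Finset.mul_sum]
    exact Finset.sum_congr rfl fun d _ => by ring

theorem isLinearMap_microTransport (S : SpatialDiscretization Nx)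
    (𝒜 : AngularDiscretization Nθ Nμ) : IsLinearMap ℝ (microTransport S 𝒜) := by
  constructor
  · intro v w
    ext i k l
    simp only [microTransport, (isLinearMap_transport S 𝒜).map_add,
      (isLinearMap_divFlux S 𝒜).map_add, Pi.add_apply]
    ring
  · intro c v
    ext i k l
    simp only [microTransport, (isLinearMap_transport S 𝒜).map_smul,
      (isLinearMap_divFlux S 𝒜).map_smul, Pi.smul_apply, smul_eq_mul]
    ring

/-! ### The diffusive equilibrium -/

/-- The microscopic tensor `-(1 / σ_s) Ω · ∇ₓ ρ` that belongs to the density `ρ` in the diffusion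
limit. -/
noncomputable def equilibrium (S : SpatialDiscretization Nx) (𝒜 : AngularDiscretization Nθ Nμ)
    (σs ρ : NodalFun Nx) : PhaseTensor Nx Nθ Nμ := fun i k l =>
  -(transportScalar S 𝒜 ρ i k l / σs i)

theorem isLinearMap_equilibrium (S : SpatialDiscretization Nx) (𝒜 : AngularDiscretization Nθ Nμ)
    (σs : NodalFun Nx) : IsLinearMap ℝ (equilibrium S 𝒜 σs) := by
  constructor
  · intro v w
    ext i k l
    simp only [equilibrium, (isLinearMap_transportScalar S 𝒜).map_add, Pi.add_apply]
    ring
  · intro c v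
    ext i k l
    simp only [equilibrium, (isLinearMap_transportScalar S 𝒜).map_smul, Pi.smul_apply,
      smul_eq_mul]
    ring

/-- The mean of `Ω_a Ω_b` over the sphere is `δ_ab / 3`. -/
theorem sphere_second_moment (a b : Fin 3) :
    (1 / (4 * Real.pi)) * ∫ φ in (0 : ℝ)..(2 * Real.pi), ∫ m in (-1 : ℝ)..1,
      direction φ m a * direction φ m b = if a = b then 1 / 3 else 0 := by
  have hπ := Real.pi_ne_zero
  have hss : ∀ c : ℝ, ∫ m in (-1 : ℝ)..1,
      (Real.sqrt (1 - m ^ 2) * Real.sqrt (1 - m ^ 2)) * c = 4 / 3 * c := by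
    intro c
    have h : ∫ m in (-1 : ℝ)..1, (Real.sqrt (1 - m ^ 2) * Real.sqrt (1 - m ^ 2)) * c
        = ∫ m in (-1 : ℝ)..1, (1 - m ^ 2) * c := by
      refine intervalIntegral.integral_congr fun m hm => ?_
      rw [Set.uIcc_of_le (by norm_num)] at hm
      have : 0 ≤ 1 - m ^ 2 := by nlinarith [hm.1, hm.2]
      simp only [Real.mul_self_sqrt this]
    rw [h, intervalIntegral.integral_mul_const, intervalIntegral.integral_sub (by simp) (by simp)]
    norm_num
  have hsm : ∀ c : ℝ, ∫ m in (-1 : ℝ)..1, (Real.sqrt (1 - m ^ 2) * m) * c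
      = (∫ m in (-1 : ℝ)..1, Real.sqrt (1 - m ^ 2) * m) * c := fun c =>
    intervalIntegral.integral_mul_const _ _
  have hcos2 : ∫ φ in (0 : ℝ)..(2 * Real.pi), Real.cos φ * Real.cos φ = Real.pi := by
    simp_rw [← sq]
    rw [integral_cos_sq]; simp
  have hsin2 : ∫ φ in (0 : ℝ)..(2 * Real.pi), Real.sin φ * Real.sin φ = Real.pi := by
    simp_rw [← sq]
    rw [integral_sin_sq]; simp
  have hsc : ∫ φ in (0 : ℝ)..(2 * Real.pi), Real.sin φ * Real.cos φ = 0 := by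
    rw [integral_sin_mul_cos₁]; simp
  have key : ∀ φ m : ℝ, ∀ p q : ℝ, (Real.sqrt (1 - m ^ 2) * p) * (Real.sqrt (1 - m ^ 2) * q)
      = (Real.sqrt (1 - m ^ 2) * Real.sqrt (1 - m ^ 2)) * (p * q) := fun _ _ _ _ => by ring
  have key1 : ∀ m p : ℝ, (Real.sqrt (1 - m ^ 2) * p) * m = (Real.sqrt (1 - m ^ 2) * m) * p :=
    fun _ _ => by ring
  have key2 : ∀ m p : ℝ, m * (Real.sqrt (1 - m ^ 2) * p) = (Real.sqrt (1 - m ^ 2) * m) * p :=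
    fun _ _ => by ring
  have hmm : ∫ m in (-1 : ℝ)..1, m * m = 2 / 3 := by
    simp_rw [← sq]
    norm_num
  have hcs : ∫ φ in (0 : ℝ)..(2 * Real.pi), Real.cos φ * Real.sin φ = 0 := by
    simp_rw [mul_comm (Real.cos _)]; exact hsc
  fin_cases a <;> fin_cases b <;>
    simp [direction, -mul_eq_mul_left_iff, -mul_eq_zero, key 0, key1, key2, hss, hsm, hmm,
      intervalIntegral.integral_const_mul, hcos2, hsin2, hsc, hcs] <;> field_simp
  all_goals norm_num

theorem AngularDiscretization.second_moment (𝒜 : AngularDiscretization Nθ Nμ) (a b : Fin 3) :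
    (1 / (4 * Real.pi)) * ∑ k, ∑ l, 𝒜.weight k l * (𝒜.Om k l a * 𝒜.Om k l b)
      = if a = b then 1 / 3 else 0 := by
  have h := 𝒜.exact_quadratic (MvPolynomial.X a * MvPolynomial.X b)
    ((MvPolynomial.totalDegree_mul _ _).trans (by simp))
  simp only [map_mul, MvPolynomial.eval_X] at h
  exact h.trans (sphere_second_moment a b)

/-- The flux of the equilibrium obeys Fick's law. -/
theorem flux_equilibrium (S : SpatialDiscretization Nx) (𝒜 : AngularDiscretization Nθ Nμ)
    (σs ρ : NodalFun Nx) (d : Fin 3) (i : Fin Nx) :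
    𝒜.flux (equilibrium S 𝒜 σs ρ) d i = -(1 / (3 * σs i)) * S.partialD d ρ i := by
  have h : 𝒜.flux (equilibrium S 𝒜 σs ρ) d i = ∑ e, -(S.partialD e ρ i / σs i) *
      ((1 / (4 * Real.pi)) * ∑ k, ∑ l, 𝒜.weight k l * (𝒜.Om k l d * 𝒜.Om k l e)) := by
    simp only [AngularDiscretization.flux, AngularDiscretization.avg, equilibrium,
      transportScalar, Fin.sum_univ_three, Finset.mul_sum, ← Finset.sum_add_distrib]
    exact Finset.sum_congr rfl fun k _ => Finset.sum_congr rfl fun l _ => by ring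
  rw [h]
  simp only [𝒜.second_moment, mul_ite, mul_zero, Finset.sum_ite_eq, Finset.mem_univ, if_true]
  ring

theorem fluxDefect_eq (S : SpatialDiscretization Nx) (𝒜 : AngularDiscretization Nθ Nμ)
    (σs ρ : NodalFun Nx) (g : PhaseTensor Nx Nθ Nμ) :
    fluxDefect S 𝒜 σs ρ g
      = Real.sqrt (∑ i, ∑ d, 𝒜.flux (equilibrium S 𝒜 σs ρ - g) d i ^ 2) := by
  unfold fluxDefect
  congr 1
  refine Finset.sum_congr rfl fun i _ => Finset.sum_congr rfl fun d _ => ?_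
  rw [(isLinearMap_flux 𝒜 d).map_sub, Pi.sub_apply, flux_equilibrium]

theorem fluxDefect_isBigO {X : Type*} {l : Filter X} (S : SpatialDiscretization Nx)
    (𝒜 : AngularDiscretization Nθ Nμ) (σs : NodalFun Nx) {ρ : X → NodalFun Nx}
    {g : X → PhaseTensor Nx Nθ Nμ} {μ : X → ℝ}
    (h : (fun x => g x - equilibrium S 𝒜 σs (ρ x)) =O[l] μ) :
    (fun x => fluxDefect S 𝒜 σs (ρ x) (g x)) =O[l] μ := by
  have h1 : ∀ (i : Fin Nx) (d : Fin 3),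
      (fun x => 𝒜.flux (equilibrium S 𝒜 σs (ρ x) - g x) d i) =O[l] μ := fun i d =>
    isBigO_pi.1 (isBigO_of_isLinearMap (isLinearMap_flux 𝒜 d)
      (h.neg_left.congr_left fun x => neg_sub _ _)) i
  have h2 : (fun x => ∑ i, ∑ d, |𝒜.flux (equilibrium S 𝒜 σs (ρ x) - g x) d i|) =O[l] μ :=
    IsBigO.fun_sum fun i _ => IsBigO.fun_sum fun d _ => (h1 i d).abs_left
  refine IsBigO.trans (isBigO_of_le _ fun x => ?_) h2
  rw [fluxDefect_eq, Real.norm_of_nonneg (Real.sqrt_nonneg _),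
    Real.norm_of_nonneg (by positivity)]
  refine Real.sqrt_le_iff.2 ⟨by positivity, ?_⟩
  have hsq : ∀ {ι : Type} (t : Finset ι) (v : ι → ℝ), (∀ a, 0 ≤ v a) →
      ∑ a ∈ t, v a ^ 2 ≤ (∑ a ∈ t, v a) ^ 2 := fun t v hv =>
    Finset.sum_sq_le_sq_sum_of_nonneg fun a _ => hv a
  calc ∑ i, ∑ d, 𝒜.flux (equilibrium S 𝒜 σs (ρ x) - g x) d i ^ 2
      ≤ ∑ i, (∑ d, |𝒜.flux (equilibrium S 𝒜 σs (ρ x) - g x) d i|) ^ 2 := by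
        refine Finset.sum_le_sum fun i _ => ?_
        simp only [← sq_abs (𝒜.flux _ _ i)]
        exact hsq _ _ fun _ => abs_nonneg _
    _ ≤ _ := hsq _ _ fun _ => by positivity

/-! ### Truncation of singular vectors -/

section Singular

variable {m n : Type*} [Fintype m] [Fintype n]

/-- The matrix `∑ a, u_a u_aᵀ`; it is the orthogonal projection onto the span of the `u_a` if
they are orthonormal. -/
noncomputable def spanProj {r : ℕ} (U : Fin r → m → ℝ) (q q' : m) : ℝ := ∑ a, U a q * U a q'

theorem singVal_antitone [DecidableEq n] (M : Matrix m n ℝ) : Antitone (singVal M) :=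
  LinearMap.singularValues_antitone _

theorem singVal_nonneg [DecidableEq n] (M : Matrix m n ℝ) (i : ℕ) : 0 ≤ singVal M i :=
  LinearMap.singularValues_nonneg _ i

theorem abs_orthonormalBasis_apply_le {ι : Type*} [Fintype ι]
    (u : OrthonormalBasis ι ℝ (EuclideanSpace ℝ m)) (a : ι) (q : m) : |u a q| ≤ 1 := by
  have h := PiLp.norm_apply_le (u a) q
  rwa [u.orthonormal.1 a] at h

theorem sum_orthonormalBasis_mul [DecidableEq m] {ι : Type*} [Fintype ι]
    (u : OrthonormalBasis ι ℝ (EuclideanSpace ℝ m)) (q q' : m) :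
    ∑ a, u a q * u a q' = if q = q' then 1 else 0 := by
  have h := u.sum_inner_mul_inner (EuclideanSpace.single q (1 : ℝ))
    (EuclideanSpace.single q' (1 : ℝ))
  simpa [EuclideanSpace.inner_single_left, EuclideanSpace.inner_single_right, Pi.single_apply,
    eq_comm] using h

/-- A unit left singular vector `v` satisfies `‖vᵀ M‖ = σ`, which bounds the entries of `vᵀ M`. -/
theorem abs_vecMul_le_of_singular {M : Matrix m n ℝ} {v : EuclideanSpace ℝ m} {σ : ℝ} (hσ : 0 ≤ σ)
    (hv : ‖v‖ = 1) (h : (M * M.transpose).mulVec v = fun q => σ ^ 2 * v q) (c : n) :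
    |∑ q, v q * M q c| ≤ σ := by
  have h1 : ∑ c, (∑ q, v q * M q c) ^ 2 = σ ^ 2 := by
    have h2 : ∑ q, v q * ((M * M.transpose).mulVec v) q = σ ^ 2 := by
      rw [h]
      have : ∑ q, v q ^ 2 = 1 := by
        have := EuclideanSpace.real_norm_sq_eq v
        rw [hv] at this
        simpa using this.symm
      calc ∑ q, v q * (σ ^ 2 * v q) = σ ^ 2 * ∑ q, v q ^ 2 := by
            rw [Finset.mul_sum]
            exact Finset.sum_congr rfl fun q _ => by ring
        _ = σ ^ 2 := by rw [this, mul_one]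
    rw [← h2, ← Matrix.mulVec_mulVec]
    have h3 : ∀ c, (M.transpose.mulVec v) c = ∑ q, v q * M q c := fun c =>
      Finset.sum_congr rfl fun q _ => mul_comm _ _
    calc ∑ c, (∑ q, v q * M q c) ^ 2
        = ∑ c, ∑ q, v q * (M q c * ∑ q, v q * M q c) := by
          refine Finset.sum_congr rfl fun c _ => ?_
          rw [sq, Finset.sum_mul]
          exact Finset.sum_congr rfl fun q _ => by ring
      _ = _ := by
          rw [Finset.sum_comm]
          refine Finset.sum_congr rfl fun q _ => ?_
          rw [← Finset.mul_sum]
          refine congrArg _ (Finset.sum_congr rfl fun c _ => ?_)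
          rw [h3]
  refine abs_le_of_sq_le_sq ?_ hσ
  rw [← h1]
  exact Finset.single_le_sum (f := fun c => (∑ q, v q * M q c) ^ 2)
    (fun c _ => sq_nonneg _) (Finset.mem_univ c)

theorem IsLeadingLeftSingular.abs_spanProj_le [DecidableEq n] {M : Matrix m n ℝ}
    {r : ℕ} {U : Fin r → m → ℝ} (hU : IsLeadingLeftSingular M r U) (q q' : m) :
    |spanProj U q q'| ≤ Fintype.card m := by
  obtain ⟨hr, u, -, hu⟩ := hU
  calc |spanProj U q q'| ≤ ∑ a, |U a q * U a q'| := Finset.abs_sum_le_sum_abs _ _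
    _ ≤ ∑ _a : Fin r, (1 : ℝ) := by
        refine Finset.sum_le_sum fun a _ => ?_
        rw [hu, hu, abs_mul]
        exact mul_le_one₀ (abs_orthonormalBasis_apply_le u _ _) (abs_nonneg _)
          (abs_orthonormalBasis_apply_le u _ _)
    _ ≤ _ := by simpa using hr

/-- Truncation to `r` leading left singular vectors changes each entry by a multiple of the first
discarded singular value. -/
theorem IsLeadingLeftSingular.abs_sub_spanProj_le [DecidableEq n] {M : Matrix m n ℝ}
    {r : ℕ} {U : Fin r → m → ℝ} (hU : IsLeadingLeftSingular M r U) (q : m) (c : n) :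
    |M q c - ∑ q', spanProj U q q' * M q' c| ≤ Fintype.card m * singVal M r := by
  classical
  obtain ⟨hr, u, hs, hu⟩ := hU
  have h1 : M q c = ∑ a, u a q * ∑ q', u a q' * M q' c := by
    have : ∀ q', ∑ a, u a q * (u a q' * M q' c) = if q = q' then M q' c else 0 := by
      intro q'
      simp_rw [← mul_assoc, ← Finset.sum_mul, sum_orthonormalBasis_mul]
      split_ifs <;> simp
    simp_rw [Finset.mul_sum]
    rw [Finset.sum_comm]
    simp [this]
  have h2 : ∑ q', spanProj U q q' * M q' c
      = ∑ a : Fin r, u (Fin.castLE hr a) q * ∑ q', u (Fin.castLE hr a) q' * M q' c := by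
    simp_rw [spanProj, Finset.sum_mul, Finset.mul_sum]
    rw [Finset.sum_comm]
    simp [hu, mul_assoc]
  have h3 : ∑ a : Fin r, u (Fin.castLE hr a) q * ∑ q', u (Fin.castLE hr a) q' * M q' c
      = ∑ a : Fin (Fintype.card m), if (a : ℕ) < r then u a q * ∑ q', u a q' * M q' c else 0 := by
    rw [← Finset.sum_filter]
    refine Finset.sum_bij (fun a _ => Fin.castLE hr a) (by simp)
      (fun a _ b _ h => Fin.ext (congrArg Fin.val h :)) (fun b hb => ?_) (fun _ _ => rfl)
    exact ⟨⟨b, (Finset.mem_filter.1 hb).2⟩, Finset.mem_univ _, rfl⟩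
  -- only the components along the discarded singular vectors remain
  rw [h2, h3, h1, ← Finset.sum_sub_distrib]
  calc _ ≤ ∑ a, |_| := Finset.abs_sum_le_sum_abs _ _
    _ ≤ ∑ _a : Fin (Fintype.card m), singVal M r := by
        refine Finset.sum_le_sum fun a _ => ?_
        split_ifs with ha
        · simpa using singVal_nonneg M r
        · rw [sub_zero, abs_mul]
          calc _ ≤ 1 * singVal M a := by
                gcongr
                · exact abs_orthonormalBasis_apply_le u _ _
                · exact abs_vecMul_le_of_singular (singVal_nonneg M a) (u.orthonormal.1 a) (hs a) c
            _ ≤ _ := by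
                rw [one_mul]
                exact singVal_antitone M (not_lt.1 ha)
    _ = _ := by simp

end Singular

/-! ### The hierarchical truncation as a product of projections -/

/-- Application of a matrix to the spatial mode. -/
def spaceAct (P : Fin Nx → Fin Nx → ℝ) (A : PhaseTensor Nx Nθ Nμ) : PhaseTensor Nx Nθ Nμ :=
  fun i k l => ∑ i', P i i' * A i' k l

/-- Application of a matrix to the pair of angular modes. -/
def angleAct (P : Fin Nθ × Fin Nμ → Fin Nθ × Fin Nμ → ℝ) (A : PhaseTensor Nx Nθ Nμ) :
    PhaseTensor Nx Nθ Nμ :=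
  fun i k l => ∑ q, P (k, l) q * A i q.1 q.2

/-- Application of a matrix to the mode `θ`. -/
def thetaAct (P : Fin Nθ → Fin Nθ → ℝ) (A : PhaseTensor Nx Nθ Nμ) : PhaseTensor Nx Nθ Nμ :=
  fun i k l => ∑ k', P k k' * A i k' l

/-- Application of a matrix to the mode `μ`. -/
def muAct (P : Fin Nμ → Fin Nμ → ℝ) (A : PhaseTensor Nx Nθ Nμ) : PhaseTensor Nx Nθ Nμ :=
  fun i k l => ∑ l', P l l' * A i k l'

theorem norm_le_of_forall_abs_le {A : PhaseTensor Nx Nθ Nμ} {c : ℝ} (hc : 0 ≤ c)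
    (h : ∀ i k l, |A i k l| ≤ c) : ‖A‖ ≤ c :=
  (pi_norm_le_iff_of_nonneg hc).2 fun i => (pi_norm_le_iff_of_nonneg hc).2 fun k =>
    (pi_norm_le_iff_of_nonneg hc).2 fun l => h i k l

theorem abs_apply_le_norm (A : PhaseTensor Nx Nθ Nμ) (i : Fin Nx) (k : Fin Nθ) (l : Fin Nμ) :
    |A i k l| ≤ ‖A‖ :=
  (norm_le_pi_norm (A i k) l).trans ((norm_le_pi_norm (A i) k).trans (norm_le_pi_norm A i))

theorem abs_sum_mul_le_card_mul {ι : Type*} [Fintype ι] {p v : ι → ℝ} {κ b : ℝ}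
    (hp : ∀ a, |p a| ≤ κ) (hv : ∀ a, |v a| ≤ b) :
    |∑ a, p a * v a| ≤ Fintype.card ι * κ * b := by
  calc |∑ a, p a * v a| ≤ ∑ a, |p a * v a| := Finset.abs_sum_le_sum_abs _ _
    _ ≤ ∑ _a : ι, κ * b := Finset.sum_le_sum fun a _ => by
        rw [abs_mul]
        exact mul_le_mul (hp a) (hv a) (abs_nonneg _) ((abs_nonneg _).trans (hp a))
    _ = _ := by simp [mul_assoc]

theorem sum_spanProj_mul {m : Type*} [Fintype m] {r : ℕ} (U : Fin r → m → ℝ) (v : m → ℝ) (q : m) :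
    ∑ q', spanProj U q q' * v q' = ∑ a, U a q * ∑ q', U a q' * v q' := by
  simp_rw [spanProj, Finset.sum_mul, Finset.mul_sum]
  rw [Finset.sum_comm]
  simp [mul_assoc]

/-- The HOSVD truncation is the projection at `{θ, μ}`, followed by the projections at `{μ}`, `{θ}`
and `{x, y}`. -/
theorem HTT.toTensor_eq_act {r : HTTRanks} (T : HTT Nx Nθ Nμ r)
    (V : Fin (r .angle) → Fin Nθ × Fin Nμ → ℝ) (A : PhaseTensor Nx Nθ Nμ)
    (hB : ∀ a b c, T.Bangle a b c = ∑ k, ∑ l, T.Utheta a k * T.Umu b l * V c (k, l))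
    (hR : ∀ a c, T.Broot a c = ∑ i, ∑ k, ∑ l, T.Uspace a i * V c (k, l) * A i k l) :
    T.toTensor = spaceAct (spanProj T.Uspace) (thetaAct (spanProj T.Utheta)
      (muAct (spanProj T.Umu) (angleAct (spanProj V) A))) := by
  have hU : ∀ c k l, T.Uangle c k l
      = ∑ k', spanProj T.Utheta k k' * ∑ l', spanProj T.Umu l l' * V c (k', l') := by
    intro c k l
    simp only [HTT.Uangle, hB, sum_spanProj_mul]
    refine Finset.sum_congr rfl fun a _ => ?_
    simp only [Finset.mul_sum, Finset.sum_mul]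
    rw [Finset.sum_comm]
    exact Finset.sum_congr rfl fun _ _ => Finset.sum_congr rfl fun _ _ =>
      Finset.sum_congr rfl fun _ _ => by ring
  have hlin : ∀ (β : Fin (r .angle) → ℝ) k l,
      ∑ k', spanProj T.Utheta k k' * ∑ l', spanProj T.Umu l l' * ∑ c, V c (k', l') * β c
        = ∑ c, β c * T.Uangle c k l := by
    intro β k l
    simp only [hU, Finset.mul_sum]
    rw [Finset.sum_comm (s := (Finset.univ : Finset (Fin (r .angle))))]
    refine Finset.sum_congr rfl fun k' _ => ?_
    rw [Finset.sum_comm]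
    exact Finset.sum_congr rfl fun _ _ => Finset.sum_congr rfl fun _ _ => by ring
  ext i k l
  simp only [spaceAct, thetaAct, muAct, angleAct, sum_spanProj_mul (U := V), hlin]
  simp only [sum_spanProj_mul, HTT.toTensor, hR]
  refine Finset.sum_congr rfl fun a _ => ?_
  simp only [Finset.mul_sum, Finset.sum_mul, Fintype.sum_prod_type]
  rw [Finset.sum_comm]
  exact Finset.sum_congr rfl fun _ _ => Finset.sum_congr rfl fun _ _ =>
    Finset.sum_congr rfl fun _ _ => Finset.sum_congr rfl fun _ _ => by ring

theorem norm_spaceAct_le {P : Fin Nx → Fin Nx → ℝ} (hP : ∀ q q', |P q q'| ≤ Nx)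
    (A : PhaseTensor Nx Nθ Nμ) : ‖spaceAct P A‖ ≤ Nx * Nx * ‖A‖ :=
  norm_le_of_forall_abs_le (by positivity) fun i k l => by
    simpa [spaceAct] using abs_sum_mul_le_card_mul (hP i) fun i' => abs_apply_le_norm A i' k l

theorem norm_thetaAct_le {P : Fin Nθ → Fin Nθ → ℝ} (hP : ∀ q q', |P q q'| ≤ Nθ)
    (A : PhaseTensor Nx Nθ Nμ) : ‖thetaAct P A‖ ≤ Nθ * Nθ * ‖A‖ :=
  norm_le_of_forall_abs_le (by positivity) fun i k l => by
    simpa [thetaAct] using abs_sum_mul_le_card_mul (hP k) fun k' => abs_apply_le_norm A i k' l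

theorem norm_muAct_le {P : Fin Nμ → Fin Nμ → ℝ} (hP : ∀ q q', |P q q'| ≤ Nμ)
    (A : PhaseTensor Nx Nθ Nμ) : ‖muAct P A‖ ≤ Nμ * Nμ * ‖A‖ :=
  norm_le_of_forall_abs_le (by positivity) fun i k l => by
    simpa [muAct] using abs_sum_mul_le_card_mul (hP l) fun l' => abs_apply_le_norm A i k l'

theorem norm_angleAct_le {P : Fin Nθ × Fin Nμ → Fin Nθ × Fin Nμ → ℝ}
    (hP : ∀ q q', |P q q'| ≤ (Nθ * Nμ : ℕ)) (A : PhaseTensor Nx Nθ Nμ) :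
    ‖angleAct P A‖ ≤ (Nθ * Nμ : ℕ) * (Nθ * Nμ : ℕ) * ‖A‖ :=
  norm_le_of_forall_abs_le (by positivity) fun i k l => by
    simpa [angleAct] using abs_sum_mul_le_card_mul (hP (k, l)) fun q => abs_apply_le_norm A i q.1 q.2

theorem spaceAct_sub (P : Fin Nx → Fin Nx → ℝ) (A B : PhaseTensor Nx Nθ Nμ) :
    spaceAct P (A - B) = spaceAct P A - spaceAct P B := by
  ext i k l
  simp [spaceAct, mul_sub]

theorem thetaAct_sub (P : Fin Nθ → Fin Nθ → ℝ) (A B : PhaseTensor Nx Nθ Nμ) :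
    thetaAct P (A - B) = thetaAct P A - thetaAct P B := by
  ext i k l
  simp [thetaAct, mul_sub]

theorem muAct_sub (P : Fin Nμ → Fin Nμ → ℝ) (A B : PhaseTensor Nx Nθ Nμ) :
    muAct P (A - B) = muAct P A - muAct P B := by
  ext i k l
  simp [muAct, mul_sub]

theorem discarded_nonneg (r : HTTRanks) (A : PhaseTensor Nx Nθ Nμ) (t : TreeNode) :
    0 ≤ discarded r A t := by
  cases t <;> exact singVal_nonneg _ _

theorem IsHOSVDTruncation.norm_le {r : HTTRanks} {A B : PhaseTensor Nx Nθ Nμ}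
    (h : IsHOSVDTruncation r A B) :
    ‖B‖ ≤ Nx * Nx * (Nθ * Nθ * (Nμ * Nμ * ((Nθ * Nμ : ℕ) * (Nθ * Nμ : ℕ)))) * ‖A‖ := by
  obtain ⟨T, V, hs, ha, ht, hm, hB, hR, rfl⟩ := h
  rw [T.toTensor_eq_act V A hB hR]
  calc _ ≤ (Nx * Nx * (Nθ * Nθ * (Nμ * Nμ * ((Nθ * Nμ : ℕ) * (Nθ * Nμ : ℕ) * ‖A‖))) : ℝ) := by
        refine (norm_spaceAct_le (fun q q' => by simpa using hs.abs_spanProj_le q q') _).trans ?_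
        gcongr
        refine (norm_thetaAct_le (fun q q' => by simpa using ht.abs_spanProj_le q q') _).trans ?_
        gcongr
        refine (norm_muAct_le (fun q q' => by simpa using hm.abs_spanProj_le q q') _).trans ?_
        gcongr
        exact norm_angleAct_le (fun q q' => by simpa using ha.abs_spanProj_le q q') _
    _ = _ := by ring

/-- Each projection moves the tensor by at most a multiple of the singular value that it discards;
these errors are carried through the remaining projections, which are bounded. -/
theorem IsHOSVDTruncation.norm_sub_le {r : HTTRanks} {A B : PhaseTensor Nx Nθ Nμ}
    (h : IsHOSVDTruncation r A B) {δ : ℝ} (hδ : ∀ t, discarded r A t ≤ δ) :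
    ‖B - A‖ ≤ (Nx * Nx * (Nθ * Nθ * (Nμ * Nμ * (Nθ * Nμ : ℕ) + Nμ) + Nθ) + Nx) * δ := by
  obtain ⟨T, V, hs, ha, ht, hm, hB, hR, rfl⟩ := h
  have hδ0 : 0 ≤ δ := (discarded_nonneg r A .space).trans (hδ .space)
  have hns : ‖spaceAct (spanProj T.Uspace) A - A‖ ≤ Nx * δ := by
    refine norm_le_of_forall_abs_le (by positivity) fun i k l => ?_
    refine (abs_sub_comm _ _).trans_le ((hs.abs_sub_spanProj_le i (k, l)).trans ?_)
    rw [Fintype.card_fin]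
    gcongr
    exact hδ .space
  have hnt : ‖thetaAct (spanProj T.Utheta) A - A‖ ≤ Nθ * δ := by
    refine norm_le_of_forall_abs_le (by positivity) fun i k l => ?_
    refine (abs_sub_comm _ _).trans_le ((ht.abs_sub_spanProj_le k (i, l)).trans ?_)
    rw [Fintype.card_fin]
    gcongr
    exact hδ .theta
  have hnm : ‖muAct (spanProj T.Umu) A - A‖ ≤ Nμ * δ := by
    refine norm_le_of_forall_abs_le (by positivity) fun i k l => ?_
    refine (abs_sub_comm _ _).trans_le ((hm.abs_sub_spanProj_le l (i, k)).trans ?_)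
    rw [Fintype.card_fin]
    gcongr
    exact hδ .mu
  have hna : ‖angleAct (spanProj V) A - A‖ ≤ (Nθ * Nμ : ℕ) * δ := by
    refine norm_le_of_forall_abs_le (by positivity) fun i k l => ?_
    refine (abs_sub_comm _ _).trans_le ((ha.abs_sub_spanProj_le (k, l) i).trans ?_)
    rw [Fintype.card_prod, Fintype.card_fin, Fintype.card_fin]
    gcongr
    exact hδ .angle
  rw [T.toTensor_eq_act V A hB hR]
  have hm' : ‖muAct (spanProj T.Umu) (angleAct (spanProj V) A) - A‖
      ≤ (Nμ * Nμ * (Nθ * Nμ : ℕ) + Nμ) * δ := by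
    refine (norm_sub_le_norm_sub_add_norm_sub _ (muAct (spanProj T.Umu) A) _).trans ?_
    rw [← muAct_sub, add_mul, mul_assoc _ _ δ]
    gcongr
    refine (norm_muAct_le (fun q q' => by simpa using hm.abs_spanProj_le q q') _).trans ?_
    gcongr
  have ht' : ‖thetaAct (spanProj T.Utheta) (muAct (spanProj T.Umu) (angleAct (spanProj V) A)) - A‖
      ≤ (Nθ * Nθ * (Nμ * Nμ * (Nθ * Nμ : ℕ) + Nμ) + Nθ) * δ := by
    refine (norm_sub_le_norm_sub_add_norm_sub _ (thetaAct (spanProj T.Utheta) A) _).trans ?_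
    rw [← thetaAct_sub, add_mul, mul_assoc _ _ δ]
    gcongr
    refine (norm_thetaAct_le (fun q q' => by simpa using ht.abs_spanProj_le q q') _).trans ?_
    gcongr
  refine (norm_sub_le_norm_sub_add_norm_sub _ (spaceAct (spanProj T.Uspace) A) _).trans ?_
  rw [← spaceAct_sub, add_mul, mul_assoc _ _ δ]
  gcongr
  refine (norm_spaceAct_le (fun q q' => by simpa using hs.abs_spanProj_le q q') _).trans ?_
  gcongr

/-! ### The largest discarded singular value -/

instance : Finite TreeNode :=
  Finite.of_surjective
    (![TreeNode.space, TreeNode.angle, TreeNode.theta, TreeNode.mu] : Fin 4 → TreeNode)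
    fun t => by
      cases t
      exacts [⟨0, rfl⟩, ⟨1, rfl⟩, ⟨2, rfl⟩, ⟨3, rfl⟩]

theorem discarded_le_maxDiscarded (r : Fin s → HTTRanks) (g : Fin s → PhaseTensor Nx Nθ Nμ)
    {J : Finset (Fin s)} {j : Fin s} (hj : j ∈ J) (t : TreeNode) :
    discarded (r j) (g j) t ≤ maxDiscarded r g J :=
  le_ciSup (f := fun p : {j // j ∈ J} × TreeNode => discarded (r p.1) (g p.1) p.2)
    (Set.finite_range _).bddAbove (⟨j, hj⟩, t)

theorem maxDiscarded_nonneg (r : Fin s → HTTRanks) (g : Fin s → PhaseTensor Nx Nθ Nμ)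
    (J : Finset (Fin s)) : 0 ≤ maxDiscarded r g J :=
  Real.iSup_nonneg fun _ => discarded_nonneg _ _ _

theorem maxDiscarded_mono (r : Fin s → HTTRanks) (g : Fin s → PhaseTensor Nx Nθ Nμ)
    {J J' : Finset (Fin s)} (h : J ⊆ J') : maxDiscarded r g J ≤ maxDiscarded r g J' :=
  Real.iSup_le (fun p => discarded_le_maxDiscarded r g (h p.1.2) p.2) (maxDiscarded_nonneg r g J')

/-! ### Well-prepared data -/

theorem isBigO_tensor_iff {X : Type*} {l : Filter X} {A : X → PhaseTensor Nx Nθ Nμ} {μ : X → ℝ} :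
    A =O[l] μ ↔ ∀ i k m, (fun x => A x i k m) =O[l] μ := by
  simp only [isBigO_pi]

theorem abs_apply_le_frobNorm (g : PhaseTensor Nx Nθ Nμ) (i : Fin Nx) (k : Fin Nθ) (l : Fin Nμ) :
    |g i k l| ≤ frobNorm g := by
  rw [← Real.sqrt_sq_eq_abs]
  refine Real.sqrt_le_sqrt ?_
  calc g i k l ^ 2 ≤ ∑ l, g i k l ^ 2 :=
        Finset.single_le_sum (f := fun l => g i k l ^ 2) (fun _ _ => sq_nonneg _)
          (Finset.mem_univ l)
    _ ≤ ∑ k, ∑ l, g i k l ^ 2 :=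
        Finset.single_le_sum (f := fun k => ∑ l, g i k l ^ 2) (fun _ _ => by positivity)
          (Finset.mem_univ k)
    _ ≤ _ :=
        Finset.single_le_sum (f := fun i => ∑ k, ∑ l, g i k l ^ 2) (fun _ _ => by positivity)
          (Finset.mem_univ i)

section Asymptotic

variable {X : Type*} {S : SpatialDiscretization Nx} {𝒜 : AngularDiscretization Nθ Nμ}
  {tab : IMEXTableau s} {σs σa : NodalFun Nx} {Q : Fin s → NodalFun Nx} {Δt εmax : ℝ}
  {ε : X → ℝ}

theorem isBigO_one_of_le (hε : ∀ x, 0 < ε x ∧ ε x ≤ εmax) :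
    ε =O[⊤] (fun _ => (1 : ℝ)) :=
  isBigO_top.2 ⟨εmax, fun x => by
    simpa [abs_of_pos (hε x).1] using (hε x).2⟩

/-- Well-prepared starting values are bounded and deviate from the equilibrium by `O(ε)`. -/
theorem WellPrepared.isBigO_data (hσs : ∀ i, 0 < σs i) (hε : ∀ x, 0 < ε x ∧ ε x ≤ εmax)
    {f : ℝ → PhaseTensor Nx Nθ Nμ} (hf : WellPrepared S 𝒜 σs εmax f) :
    (fun x => macroPart 𝒜 (f (ε x))) =O[⊤] (fun _ => (1 : ℝ)) ∧
    (fun x => microPart 𝒜 (ε x) (f (ε x))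
      - equilibrium S 𝒜 σs (macroPart 𝒜 (f (ε x)))) =O[⊤] ε := by
  obtain ⟨f₀, f₁, h₀, h₁, K, hK⟩ := hf
  have hε1 := isBigO_one_of_le hε
  set R : X → PhaseTensor Nx Nθ Nμ := fun x => f (ε x) - (f₀ + ε x • f₁) with hR
  have hRO : R =O[⊤] fun x => ε x * ε x := by
    refine isBigO_top.2 ⟨|K|, fun x => ?_⟩
    have h := hK (ε x) (hε x).1 (hε x).2
    refine norm_le_of_forall_abs_le (by positivity) fun i k l => ?_
    refine (abs_apply_le_frobNorm (R x) i k l).trans (h.trans ?_)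
    rw [Real.norm_of_nonneg (mul_self_nonneg _), ← sq]
    exact mul_le_mul_of_nonneg_right (le_abs_self K) (sq_nonneg _)
  have hfR : ∀ x, f (ε x) = f₀ + ε x • f₁ + R x := fun x => by simp [hR]
  have hεε : (fun x => ε x * ε x) =O[⊤] ε := by
    simpa using (isBigO_refl ε ⊤).mul hε1
  have hmean : ∀ x, macroPart 𝒜 (f (ε x)) = 𝒜.avg f₀ + ε x • 𝒜.avg f₁ + 𝒜.avg (R x) := by
    intro x
    rw [macroPart, hfR, (isLinearMap_avg 𝒜).map_add, (isLinearMap_avg 𝒜).map_add,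
      (isLinearMap_avg 𝒜).map_smul]
  have hconst : ∀ {E : Type} [NormedAddCommGroup E] (c : E),
      (fun _ : X => c) =O[⊤] fun _ => (1 : ℝ) := fun c => isBigO_const_const c one_ne_zero _
  have hsmul : ∀ {E : Type} [NormedAddCommGroup E] [NormedSpace ℝ E] (c : E),
      (fun x => ε x • c) =O[⊤] ε := fun c => by
    simpa using (isBigO_refl ε ⊤).smul (hconst c)
  have hav : (fun x => 𝒜.avg (R x)) =O[⊤] fun x => ε x * ε x :=
    isBigO_of_isLinearMap (isLinearMap_avg 𝒜) hRO
  refine ⟨?_, ?_⟩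
  · simp_rw [hmean]
    exact ((hconst _).add ((hsmul _).trans hε1)).add (hav.trans (hεε.trans hε1))
  · have hf₀ : ∀ i k l, f₀ i k l = 𝒜.avg f₀ i := fun i k l => by
      have := (mul_eq_zero.1 (h₀ i k l)).resolve_left (hσs i).ne'
      linarith
    -- the leading term of the microscopic part is the equilibrium of the leading density
    have hf₁ : ∀ i k l, f₁ i k l - 𝒜.avg f₁ i = equilibrium S 𝒜 σs (𝒜.avg f₀) i k l := by
      intro i k l
      have ht : transport S 𝒜 f₀ i k l = transportScalar S 𝒜 (𝒜.avg f₀) i k l := by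
        simp only [transport, transportScalar, gradTensor]
        refine Finset.sum_congr rfl fun d _ => ?_
        congr 2
        ext i'
        exact hf₀ i' k l
      have h := h₁ i k l
      rw [ht] at h
      rw [equilibrium, h, mul_div_cancel_left₀ _ (hσs i).ne']
      ring
    have hE := isLinearMap_equilibrium S 𝒜 σs
    have hEG : (fun x => ε x • equilibrium S 𝒜 σs (𝒜.avg f₁)
        + equilibrium S 𝒜 σs (𝒜.avg (R x))) =O[⊤] ε :=
      (hsmul _).add ((isBigO_of_isLinearMap hE hav).trans hεε)
    rw [isBigO_tensor_iff] at hEG hRO ⊢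
    intro i k l
    have hq : (fun x => (R x i k l - 𝒜.avg (R x) i) / ε x) =O[⊤] ε := by
      have h := ((hRO i k l).sub (isBigO_pi.1 hav i)).mul (isBigO_refl (fun x => (ε x)⁻¹) ⊤)
      refine h.congr (fun x => rfl) fun x => ?_
      have := (hε x).1.ne'
      field_simp
    refine (hq.sub (hEG i k l)).congr_left fun x => ?_
    have hx := (hε x).1.ne'
    have e1 : f (ε x) i k l = f₀ i k l + ε x * f₁ i k l + R x i k l := by
      conv_lhs => rw [hfR]
      rfl
    have e2 := congrFun (hmean x) i
    simp only [macroPart, Pi.add_apply, Pi.smul_apply, smul_eq_mul] at e2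
    rw [Pi.sub_apply, Pi.sub_apply, Pi.sub_apply, hmean, hE.map_add, hE.map_add, hE.map_smul,
      microPart, e1, e2, hf₀ i k l]
    simp only [Pi.add_apply, Pi.smul_apply, smul_eq_mul, ← hf₁]
    field_simp
    ring

/-! ### One stage of the scheme -/

/-- The stage equation for `g`, written for the deviation from the equilibrium. -/
theorem StageEquations.deviation_eq {e : ℝ} (he : 0 < e) (hσs : ∀ i, 0 < σs i)
    {ρn : NodalFun Nx} {gn : PhaseTensor Nx Nθ Nμ} {h g : Fin s → PhaseTensor Nx Nθ Nμ}
    {ρ : Fin s → NodalFun Nx} (H : StageEquations S 𝒜 tab σs σa Q Δt e ρn gn h ρ g)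
    (ℓ : Fin s) (i : Fin Nx) (k : Fin Nθ) (l : Fin Nμ) :
    (e ^ 2 + tab.Aim ℓ ℓ * Δt * σs i) * (g ℓ - equilibrium S 𝒜 σs (ρ ℓ)) i k l
      = e * (e * (gn - equilibrium S 𝒜 σs (ρ ℓ)) i k l)
        - Δt * (e * ∑ j ∈ Finset.Iio ℓ, tab.Aex ℓ j * microTransport S 𝒜 (h j) i k l)
        - Δt * σa i * (e * (e * ∑ j ∈ Finset.Iio ℓ, tab.Aex ℓ j * h j i k l))
        - Δt * σs i * ∑ j ∈ Finset.Iio ℓ,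
          tab.Aim ℓ j * (h j - equilibrium S 𝒜 σs (ρ j)) i k l := by
  have hσ := (hσs i).ne'
  have hE : ∀ ρ : NodalFun Nx,
      transportScalar S 𝒜 ρ i k l = -σs i * equilibrium S 𝒜 σs ρ i k l := fun ρ => by
    rw [equilibrium]
    field_simp
  have h1 := (H ℓ).2 i k l
  have h2 : ∑ j ∈ Finset.Iio ℓ,
      tab.Aim ℓ j * (transportScalar S 𝒜 (ρ j) i k l + σs i * h j i k l)
      = σs i * ∑ j ∈ Finset.Iio ℓ, tab.Aim ℓ j * (h j - equilibrium S 𝒜 σs (ρ j)) i k l := by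
    rw [Finset.mul_sum]
    refine Finset.sum_congr rfl fun j _ => ?_
    rw [hE, Pi.sub_apply, Pi.sub_apply, Pi.sub_apply]
    ring
  have h3 : ∑ j ∈ Finset.Iio ℓ, tab.Aex ℓ j * (σa i * h j i k l)
      = σa i * ∑ j ∈ Finset.Iio ℓ, tab.Aex ℓ j * h j i k l := by
    rw [Finset.mul_sum]
    exact Finset.sum_congr rfl fun j _ => by ring
  rw [h2, h3, hE] at h1
  have h4 : e ^ 2 * g ℓ i k l = e ^ 2 * _ := congrArg _ h1
  have hne := he.ne'
  field_simp at h4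
  simp only [Pi.sub_apply]
  linear_combination h4

/-- The factor that multiplies the deviation from the equilibrium stays away from zero, also in
the limit `ε → 0`. -/
theorem exists_pos_le_abs_stage_factor {a : ℝ} (ha : a ≠ 0)
    (h : ∀ e, 0 < e → e ≤ εmax → e ^ 2 + a ≠ 0) :
    ∃ κ > 0, ∀ e, 0 < e → e ≤ εmax → κ ≤ |e ^ 2 + a| := by
  have hc : ContinuousOn (fun e : ℝ => |e ^ 2 + a|) (Set.Icc 0 εmax) := by fun_prop
  obtain ⟨κ, hκ, hle⟩ := isCompact_Icc.exists_forall_le' hc (a := 0) fun e he => by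
    rcases he.1.eq_or_lt with rfl | h0
    · simpa using ha
    · exact abs_pos.2 (h e h0 he.2)
  exact ⟨κ, hκ, fun e h0 h1 => hle e ⟨h0.le, h1⟩⟩

theorem StageEquations.isBigO_density {ρn : X → NodalFun Nx} {gn : X → PhaseTensor Nx Nθ Nμ}
    {h g : X → Fin s → PhaseTensor Nx Nθ Nμ} {ρ : X → Fin s → NodalFun Nx}
    (H : ∀ x, StageEquations S 𝒜 tab σs σa Q Δt (ε x) (ρn x) (gn x) (h x) (ρ x) (g x))
    (hρn : ρn =O[⊤] fun _ => (1 : ℝ)) {ℓ : Fin s}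
    (hρ : ∀ j < ℓ, (fun x => ρ x j) =O[⊤] fun _ => (1 : ℝ))
    (hh : ∀ j < ℓ, (fun x => h x j) =O[⊤] fun _ => (1 : ℝ)) :
    (fun x => ρ x ℓ) =O[⊤] fun _ => (1 : ℝ) := by
  refine isBigO_pi.2 fun i => ?_
  refine IsBigO.congr_left ?_ fun x => ((H x ℓ).1 i).symm
  refine (isBigO_pi.1 hρn i).add (IsBigO.const_mul_left (IsBigO.fun_sum fun j hj => ?_) _)
  have hj := Finset.mem_Iio.1 hj
  refine IsBigO.const_mul_left (IsBigO.add (IsBigO.sub ?_ ?_) ?_) _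
  · exact (isBigO_pi.1 (isBigO_of_isLinearMap (isLinearMap_divFlux S 𝒜) (hh j hj)) i).neg_left
  · exact (isBigO_pi.1 (hρ j hj) i).const_mul_left _
  · exact isBigO_const_const _ one_ne_zero _

/-- If the tensors that enter stage `ℓ` deviate from the equilibrium by `O(μ)`, so does its
result. -/
theorem StageEquations.isBigO_deviation {ρn : X → NodalFun Nx} {gn : X → PhaseTensor Nx Nθ Nμ}
    {h g : X → Fin s → PhaseTensor Nx Nθ Nμ} {ρ : X → Fin s → NodalFun Nx}
    (H : ∀ x, StageEquations S 𝒜 tab σs σa Q Δt (ε x) (ρn x) (gn x) (h x) (ρ x) (g x))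
    (hσs : ∀ i, 0 < σs i) (hΔt : 0 < Δt) (hε : ∀ x, 0 < ε x ∧ ε x ≤ εmax)
    (hsolv : ∀ e, 0 < e → e ≤ εmax → ∀ ℓ i, e ^ 2 + tab.Aim ℓ ℓ * Δt * σs i ≠ 0)
    (hρn : ρn =O[⊤] fun _ => (1 : ℝ))
    (hgn : (fun x => gn x - equilibrium S 𝒜 σs (ρn x)) =O[⊤] ε) {ℓ : Fin s} {μ : X → ℝ}
    (hμ : ε =O[⊤] μ)
    (hρ : ∀ j < ℓ, (fun x => ρ x j) =O[⊤] fun _ => (1 : ℝ))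
    (hh : ∀ j < ℓ, (fun x => h x j) =O[⊤] fun _ => (1 : ℝ))
    (hd : ∀ j < ℓ, (fun x => h x j - equilibrium S 𝒜 σs (ρ x j)) =O[⊤] μ) :
    (fun x => g x ℓ - equilibrium S 𝒜 σs (ρ x ℓ)) =O[⊤] μ := by
  have hE := isLinearMap_equilibrium S 𝒜 σs
  have hε1 := isBigO_one_of_le hε
  have hρℓ := StageEquations.isBigO_density H hρn hρ hh
  have hgn1 : (fun x => gn x - equilibrium S 𝒜 σs (ρ x ℓ)) =O[⊤] fun _ => (1 : ℝ) := by
    refine (((hgn.trans hε1).add (isBigO_of_isLinearMap hE hρn)).sub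
      (isBigO_of_isLinearMap hE hρℓ)).congr_left fun x => ?_
    simp
  have hεmul : ∀ {v : X → ℝ}, v =O[⊤] (fun _ => (1 : ℝ)) → (fun x => ε x * v x) =O[⊤] ε :=
    fun hv => by simpa using (isBigO_refl ε ⊤).mul hv
  refine isBigO_tensor_iff.2 fun i k l => ?_
  by_cases ha : tab.Aim ℓ ℓ = 0
  · -- only the first stage may be explicit; it returns the starting values
    have hℓ : Finset.Iio ℓ = ∅ := by
      have h0 : ¬ 0 < (ℓ : ℕ) := fun h => tab.diag_ne_zero ℓ h ha
      ext j
      simp only [Finset.mem_Iio, Finset.notMem_empty, iff_false]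
      intro hj
      exact h0 ((Nat.zero_le _).trans_lt (Fin.lt_def.1 hj))
    have hρeq : ∀ x, ρ x ℓ = ρn x := fun x => by
      ext i'
      simpa [hℓ] using (H x ℓ).1 i'
    refine ((isBigO_tensor_iff.1 hgn i k l).trans hμ).congr_left fun x => ?_
    have h1 := (H x).deviation_eq (hε x).1 hσs ℓ i k l
    rw [ha, hℓ] at h1
    simp only [Finset.sum_empty, zero_mul, mul_zero, sub_zero, add_zero, hρeq] at h1
    have h2 : ε x ^ 2 ≠ 0 := pow_ne_zero _ (hε x).1.ne'
    rw [hρeq]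
    refine (mul_left_cancel₀ h2 ?_).symm
    rw [h1]
    ring
  · have hne : tab.Aim ℓ ℓ * Δt * σs i ≠ 0 := mul_ne_zero (mul_ne_zero ha hΔt.ne') (hσs i).ne'
    obtain ⟨κ, hκ, hle⟩ := exists_pos_le_abs_stage_factor (εmax := εmax) hne
      fun e h0 h1 => hsolv e h0 h1 ℓ i
    have hinv : (fun x => (ε x ^ 2 + tab.Aim ℓ ℓ * Δt * σs i)⁻¹) =O[⊤] fun _ => (1 : ℝ) := by
      refine isBigO_top.2 ⟨κ⁻¹, fun x => ?_⟩
      rw [norm_inv, Real.norm_eq_abs, norm_one, mul_one]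
      exact inv_anti₀ hκ (hle _ (hε x).1 (hε x).2)
    have hrhs : (fun x => (ε x ^ 2 + tab.Aim ℓ ℓ * Δt * σs i)
        * (g x ℓ - equilibrium S 𝒜 σs (ρ x ℓ)) i k l) =O[⊤] μ := by
      refine IsBigO.congr_left ?_ fun x => ((H x).deviation_eq (hε x).1 hσs ℓ i k l).symm
      refine IsBigO.sub (IsBigO.sub (IsBigO.sub ?_ ?_) ?_) ?_
      · exact (hεmul ((hεmul (isBigO_tensor_iff.1 hgn1 i k l)).trans hε1)).trans hμ
      · refine IsBigO.const_mul_left ((hεmul (IsBigO.fun_sum fun j hj => ?_)).trans hμ) _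
        exact (isBigO_tensor_iff.1 (isBigO_of_isLinearMap (isLinearMap_microTransport S 𝒜)
          (hh j (Finset.mem_Iio.1 hj))) i k l).const_mul_left _
      · refine IsBigO.const_mul_left ((hεmul ((hεmul
          (IsBigO.fun_sum fun j hj => ?_)).trans hε1)).trans hμ) _
        exact (isBigO_tensor_iff.1 (hh j (Finset.mem_Iio.1 hj)) i k l).const_mul_left _
      · refine IsBigO.const_mul_left (IsBigO.fun_sum fun j hj => ?_) _
        exact (isBigO_tensor_iff.1 (hd j (Finset.mem_Iio.1 hj)) i k l).const_mul_left _
    refine (hinv.mul hrhs).congr (fun x => ?_) fun x => one_mul _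
    rw [inv_mul_cancel_left₀ (hsolv _ (hε x).1 (hε x).2 ℓ i)]

/-! ### All stages -/

/-- All stages stay bounded, and the deviation of stage `ℓ` from the equilibrium is bounded by
`ε` and the perturbations `h j - g j` of the earlier stages.  Here `μ ℓ` is any family of bounds
for these that grows with `ℓ`. -/
theorem StageEquations.isBigO_stages {ρn : X → NodalFun Nx} {gn : X → PhaseTensor Nx Nθ Nμ}
    {h g : X → Fin s → PhaseTensor Nx Nθ Nμ} {ρ : X → Fin s → NodalFun Nx}
    (H : ∀ x, StageEquations S 𝒜 tab σs σa Q Δt (ε x) (ρn x) (gn x) (h x) (ρ x) (g x))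
    (hσs : ∀ i, 0 < σs i) (hΔt : 0 < Δt) (hε : ∀ x, 0 < ε x ∧ ε x ≤ εmax)
    (hsolv : ∀ e, 0 < e → e ≤ εmax → ∀ ℓ i, e ^ 2 + tab.Aim ℓ ℓ * Δt * σs i ≠ 0)
    (hρn : ρn =O[⊤] fun _ => (1 : ℝ))
    (hgn : (fun x => gn x - equilibrium S 𝒜 σs (ρn x)) =O[⊤] ε)
    (hhg : ∀ j, (fun x => h x j) =O[⊤] fun x => g x j)
    {μ : Fin s → X → ℝ} (hμ : ∀ ℓ, ε =O[⊤] μ ℓ) (hμmono : ∀ j ℓ, j < ℓ → μ j =O[⊤] μ ℓ)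
    (hpert : ∀ j ℓ, j < ℓ → (fun x => h x j - g x j) =O[⊤] μ ℓ) (ℓ : Fin s) :
    (fun x => ρ x ℓ) =O[⊤] (fun _ => (1 : ℝ)) ∧ (fun x => g x ℓ) =O[⊤] (fun _ => (1 : ℝ)) ∧
      (fun x => g x ℓ - equilibrium S 𝒜 σs (ρ x ℓ)) =O[⊤] μ ℓ := by
  have hE := isLinearMap_equilibrium S 𝒜 σs
  induction ℓ using WellFoundedLT.induction with
  | ind ℓ ih =>
    have hρ : ∀ j < ℓ, (fun x => ρ x j) =O[⊤] fun _ => (1 : ℝ) := fun j hj => (ih j hj).1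
    have hh : ∀ j < ℓ, (fun x => h x j) =O[⊤] fun _ => (1 : ℝ) := fun j hj =>
      (hhg j).trans (ih j hj).2.1
    have hρℓ := StageEquations.isBigO_density H hρn hρ hh
    refine ⟨hρℓ, ?_, ?_⟩
    -- boundedness comes first, with the bound `1` in place of `μ ℓ`: nothing bounds `μ ℓ` itself
    · have hd1 := StageEquations.isBigO_deviation H hσs hΔt hε hsolv hρn hgn
        (isBigO_one_of_le hε) hρ hh fun j hj => (hh j hj).sub (isBigO_of_isLinearMap hE (hρ j hj))
      exact (hd1.add (isBigO_of_isLinearMap hE hρℓ)).congr_left fun x => sub_add_cancel _ _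
    · refine StageEquations.isBigO_deviation H hσs hΔt hε hsolv hρn hgn (hμ ℓ) hρ hh
        fun j hj => ?_
      exact ((hpert j ℓ hj).add ((ih j hj).2.2.trans (hμmono j ℓ hj))).congr_left
        fun x => sub_add_sub_cancel _ _ _

/-- Two schemes with the same starting values whose fluxes are close to equilibrium have close
densities. -/
theorem StageEquations.isBigO_density_sub {ρn : X → NodalFun Nx}
    {gn : X → PhaseTensor Nx Nθ Nμ} {h g h' g' : X → Fin s → PhaseTensor Nx Nθ Nμ}
    {ρ ρ' : X → Fin s → NodalFun Nx}
    (H : ∀ x, StageEquations S 𝒜 tab σs σa Q Δt (ε x) (ρn x) (gn x) (h x) (ρ x) (g x))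
    (H' : ∀ x, StageEquations S 𝒜 tab σs σa Q Δt (ε x) (ρn x) (gn x) (h' x) (ρ' x) (g' x))
    {μ : Fin s → X → ℝ} (hμmono : ∀ j ℓ, j < ℓ → μ j =O[⊤] μ ℓ)
    (hd : ∀ j ℓ, j < ℓ → (fun x => h x j - equilibrium S 𝒜 σs (ρ x j)) =O[⊤] μ ℓ)
    (hd' : ∀ j ℓ, j < ℓ → (fun x => h' x j - equilibrium S 𝒜 σs (ρ' x j)) =O[⊤] μ ℓ)
    (ℓ : Fin s) : (fun x => ρ x ℓ - ρ' x ℓ) =O[⊤] μ ℓ := by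
  have hE := isLinearMap_equilibrium S 𝒜 σs
  induction ℓ using WellFoundedLT.induction with
  | ind ℓ ih =>
    refine isBigO_pi.2 fun i => ?_
    have hsum : (fun x => Δt * ∑ j ∈ Finset.Iio ℓ, tab.Aex ℓ j *
        (-divFlux S 𝒜 (h x j - h' x j) i - σa i * (ρ x j - ρ' x j) i)) =O[⊤] μ ℓ := by
      refine IsBigO.const_mul_left (IsBigO.fun_sum fun j hj => ?_) _
      have hj := Finset.mem_Iio.1 hj
      have hρ := (ih j hj).trans (hμmono j ℓ hj)
      have hh : (fun x => h x j - h' x j) =O[⊤] μ ℓ := by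
        refine (((hd j ℓ hj).sub (hd' j ℓ hj)).add (isBigO_of_isLinearMap hE hρ)).congr_left
          fun x => ?_
        rw [hE.map_sub]
        abel
      exact ((isBigO_pi.1 (isBigO_of_isLinearMap (isLinearMap_divFlux S 𝒜) hh) i).neg_left.sub
        ((isBigO_pi.1 hρ i).const_mul_left _)).const_mul_left _
    refine hsum.congr_left fun x => ?_
    rw [Pi.sub_apply, (H x ℓ).1 i, (H' x ℓ).1 i, add_sub_add_left_eq_sub, ← mul_sub,
      ← Finset.sum_sub_distrib]
    refine congrArg _ (Finset.sum_congr rfl fun j _ => ?_)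
    rw [(isLinearMap_divFlux S 𝒜).map_sub, Pi.sub_apply, Pi.sub_apply]
    ring

end Asymptotic

/-! ### Runs of the two schemes -/

/-- The quantities of one full-grid and one low-rank run of the scheme. -/
structure SchemeData (Nx Nθ Nμ s : ℕ) where
  /-- scaling parameter -/
  ε : ℝ
  /-- hierarchical ranks of each stage -/
  r : Fin s → HTTRanks
  /-- densities of the full-grid scheme -/
  ρ : Fin s → NodalFun Nx
  /-- microscopic tensors of the full-grid scheme -/
  g : Fin s → PhaseTensor Nx Nθ Nμ
  /-- densities of the low-rank scheme -/
  ρlr : Fin s → NodalFun Nx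
  /-- microscopic tensors of the low-rank scheme before truncation -/
  glr : Fin s → PhaseTensor Nx Nθ Nμ
  /-- microscopic tensors of the low-rank scheme after truncation -/
  gtr : Fin s → PhaseTensor Nx Nθ Nμ

/-- `D` consists of runs of the two schemes with starting values taken from `f ε`. -/
structure SchemeData.IsRun (S : SpatialDiscretization Nx) (𝒜 : AngularDiscretization Nθ Nμ)
    (tab : IMEXTableau s) (σs σa : NodalFun Nx) (Q : Fin s → NodalFun Nx) (Δt εmax : ℝ)
    (f : ℝ → PhaseTensor Nx Nθ Nμ) (D : SchemeData Nx Nθ Nμ s) : Prop where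
  pos : 0 < D.ε
  le : D.ε ≤ εmax
  full : StageEquations S 𝒜 tab σs σa Q Δt D.ε (macroPart 𝒜 (f D.ε)) (microPart 𝒜 D.ε (f D.ε))
    D.g D.ρ D.g
  lowRank : StageEquations S 𝒜 tab σs σa Q Δt D.ε (macroPart 𝒜 (f D.ε))
    (microPart 𝒜 D.ε (f D.ε)) D.gtr D.ρlr D.glr
  trunc : ∀ j, IsHOSVDTruncation (D.r j) (D.glr j) (D.gtr j)

/-- The bound `ε + (2 + ε) max σ` for the stages in `J`. -/
noncomputable def SchemeData.bound (D : SchemeData Nx Nθ Nμ s) (J : Finset (Fin s)) : ℝ :=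
  D.ε + (2 + D.ε) * maxDiscarded D.r D.glr J

theorem SchemeData.bound_mono (D : SchemeData Nx Nθ Nμ s) (hε : 0 < D.ε) {J J' : Finset (Fin s)}
    (h : J ⊆ J') : D.bound J ≤ D.bound J' := by
  have := maxDiscarded_mono D.r D.glr h
  unfold SchemeData.bound
  gcongr

theorem SchemeData.le_bound (D : SchemeData Nx Nθ Nμ s) (hε : 0 < D.ε) (J : Finset (Fin s)) :
    D.ε ≤ D.bound J :=
  le_add_of_nonneg_right (mul_nonneg (by linarith) (maxDiscarded_nonneg _ _ _))

theorem SchemeData.bound_nonneg (D : SchemeData Nx Nθ Nμ s) (hε : 0 < D.ε)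
    (J : Finset (Fin s)) : 0 ≤ D.bound J :=
  hε.le.trans (D.le_bound hε J)

theorem SchemeData.discarded_le_bound (D : SchemeData Nx Nθ Nμ s) (hε : 0 < D.ε)
    {J : Finset (Fin s)} {j : Fin s} (hj : j ∈ J) (t : TreeNode) :
    discarded (D.r j) (D.glr j) t ≤ D.bound J := by
  have h1 := discarded_le_maxDiscarded D.r D.glr hj t
  have h2 := maxDiscarded_nonneg D.r D.glr J
  unfold SchemeData.bound
  nlinarith

/-- The claim for a single stage, with constants that may depend on the stage. -/
theorem fluxDefect_isBigO_bound (S : SpatialDiscretization Nx)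
    (𝒜 : AngularDiscretization Nθ Nμ) (tab : IMEXTableau s)
    (σs σa : NodalFun Nx) (hσs : ∀ i, 0 < σs i)
    (Q : Fin s → NodalFun Nx) (Δt : ℝ) (hΔt : 0 < Δt) (εmax : ℝ)
    (hsolv : ∀ ε, 0 < ε → ε ≤ εmax → ∀ ℓ i, ε ^ 2 + tab.Aim ℓ ℓ * Δt * σs i ≠ 0)
    (f : ℝ → PhaseTensor Nx Nθ Nμ) (hf : WellPrepared S 𝒜 σs εmax f) (ℓ : Fin s)
    (R : SchemeData Nx Nθ Nμ s → NodalFun Nx) (hR : R = (fun D => D.ρ ℓ) ∨ R = fun D => D.ρlr ℓ) :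
    ((fun D : {D // SchemeData.IsRun S 𝒜 tab σs σa Q Δt εmax f D} =>
      fluxDefect S 𝒜 σs (R D) (D.1.glr ℓ)) =O[⊤] fun D => D.1.bound (Finset.Iio ℓ)) ∧
    ((fun D : {D // SchemeData.IsRun S 𝒜 tab σs σa Q Δt εmax f D} =>
      fluxDefect S 𝒜 σs (R D) (D.1.gtr ℓ)) =O[⊤] fun D => D.1.bound (Finset.Iic ℓ)) := by
  set X := {D // SchemeData.IsRun S 𝒜 tab σs σa Q Δt εmax f D}
  have hE := isLinearMap_equilibrium S 𝒜 σs
  have hε : ∀ D : X, 0 < D.1.ε ∧ D.1.ε ≤ εmax := fun D => ⟨D.2.pos, D.2.le⟩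
  obtain ⟨hρn, hgn⟩ := hf.isBigO_data hσs hε
  have hmono : ∀ J J' : Finset (Fin s), J ⊆ J' →
      (fun D : X => D.1.bound J) =O[⊤] fun D => D.1.bound J' := fun J J' h =>
    isBigO_of_le _ fun D => by
      rw [Real.norm_of_nonneg (D.1.bound_nonneg D.2.pos _),
        Real.norm_of_nonneg (D.1.bound_nonneg D.2.pos _)]
      exact D.1.bound_mono D.2.pos h
  have hεb : ∀ J : Finset (Fin s), (fun D : X => D.1.ε) =O[⊤] fun D => D.1.bound J := fun J =>
    isBigO_of_le _ fun D => by
      rw [Real.norm_of_nonneg D.2.pos.le, Real.norm_of_nonneg (D.1.bound_nonneg D.2.pos _)]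
      exact D.1.le_bound D.2.pos J
  have htr : ∀ (j : Fin s) (J : Finset (Fin s)), j ∈ J →
      (fun D : X => D.1.gtr j - D.1.glr j) =O[⊤] fun D => D.1.bound J := fun j J hj =>
    isBigO_top.2 ⟨_, fun D => by
      rw [Real.norm_of_nonneg (D.1.bound_nonneg D.2.pos _)]
      exact (D.2.trunc j).norm_sub_le fun t => D.1.discarded_le_bound D.2.pos hj t⟩
  have hlt : ∀ j ℓ : Fin s, j < ℓ → Finset.Iio j ⊆ Finset.Iio ℓ := fun j ℓ h =>
    Finset.Iio_subset_Iio h.le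
  have hfull := StageEquations.isBigO_stages (fun D : X => D.2.full) hσs hΔt hε hsolv hρn hgn
    (fun j => isBigO_refl _ _) (μ := fun _ D => D.1.ε) (fun _ => isBigO_refl _ _)
    (fun _ _ _ => isBigO_refl _ _) fun j ℓ _ => by
      exact (isBigO_zero (E' := PhaseTensor Nx Nθ Nμ) _ _).congr_left fun D => (sub_self _).symm
  have hlow := StageEquations.isBigO_stages (fun D : X => D.2.lowRank) hσs hΔt hε hsolv hρn hgn
    (fun j => isBigO_top.2 ⟨_, fun D => (D.2.trunc j).norm_le⟩)
    (μ := fun ℓ D => D.1.bound (Finset.Iio ℓ)) (fun _ => hεb _)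
    (fun j ℓ h => hmono _ _ (hlt j ℓ h)) fun j ℓ h => htr j _ (Finset.mem_Iio.2 h)
  have hdens := StageEquations.isBigO_density_sub (fun D : X => D.2.full)
    (fun D : X => D.2.lowRank) (μ := fun ℓ D => D.1.bound (Finset.Iio ℓ))
    (fun j ℓ h => hmono _ _ (hlt j ℓ h)) (fun j ℓ _ => (hfull j).2.2.trans (hεb _))
    (fun j ℓ h => ((htr j _ (Finset.mem_Iio.2 h)).add
      ((hlow j).2.2.trans (hmono _ _ (hlt j ℓ h)))).congr_left fun D => sub_add_sub_cancel _ _ _) ℓ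
  have hmain : (fun D : X => D.1.glr ℓ - equilibrium S 𝒜 σs (R D))
      =O[⊤] fun D => D.1.bound (Finset.Iio ℓ) := by
    rcases hR with rfl | rfl
    · refine ((hlow ℓ).2.2.sub (isBigO_of_isLinearMap hE hdens)).congr_left fun D => ?_
      rw [hE.map_sub]
      abel
    · exact (hlow ℓ).2.2
  refine ⟨fluxDefect_isBigO S 𝒜 σs hmain, fluxDefect_isBigO S 𝒜 σs ?_⟩
  exact ((htr ℓ _ (Finset.mem_Iic.2 le_rfl)).add (hmain.trans
    (hmono _ _ Finset.Iio_subset_Iic_self))).congr_left fun D => sub_add_sub_cancel _ _ _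

end TransportHTT

theorem lemma3p3 {Nx Nθ Nμ s : ℕ} (S : SpatialDiscretization Nx)
    (𝒜 : AngularDiscretization Nθ Nμ) (tab : IMEXTableau s)
    (σs σa : NodalFun Nx) (hσs : ∀ i, 0 < σs i) (hσa : ∀ i, 0 ≤ σa i)
    (Q : Fin s → NodalFun Nx) (Δt : ℝ) (hΔt : 0 < Δt) (εmax : ℝ) (hεmax : 0 < εmax)
    -- the stage equations can be solved
    (hsolv : ∀ ε, 0 < ε → ε ≤ εmax → ∀ ℓ i, ε ^ 2 + tab.Aim ℓ ℓ * Δt * σs i ≠ 0)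
    -- initial data
    (f : ℝ → PhaseTensor Nx Nθ Nμ) (hf : WellPrepared S 𝒜 σs εmax f)
    (hgrad : ∃ M : ℝ, ∀ ε, 0 < ε → ε ≤ εmax → gradNorm S (microPart 𝒜 ε (f ε)) ≤ M) :
    ∃ C : ℝ, 0 < C ∧ ∀ ε, 0 < ε → ε ≤ εmax →
      ∀ (r : Fin s → HTTRanks)
        -- full-grid scheme
        (ρ : Fin s → NodalFun Nx) (g : Fin s → PhaseTensor Nx Nθ Nμ)
        -- low-rank scheme: densities, microscopic tensors before and after truncation
        (ρlr : Fin s → NodalFun Nx) (glr gtr : Fin s → PhaseTensor Nx Nθ Nμ),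
      StageEquations S 𝒜 tab σs σa Q Δt ε (macroPart 𝒜 (f ε)) (microPart 𝒜 ε (f ε)) g ρ g →
      StageEquations S 𝒜 tab σs σa Q Δt ε (macroPart 𝒜 (f ε)) (microPart 𝒜 ε (f ε)) gtr ρlr glr →
      (∀ j, IsHOSVDTruncation (r j) (glr j) (gtr j)) →
      ∀ ℓ : Fin s, ∀ R ∈ ({ρ ℓ, ρlr ℓ} : Set (NodalFun Nx)),
        fluxDefect S 𝒜 σs R (glr ℓ)
            ≤ C * (ε + (2 + ε) * maxDiscarded r glr (Finset.Iio ℓ)) ∧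
        fluxDefect S 𝒜 σs R (gtr ℓ)
            ≤ C * (ε + (2 + ε) * maxDiscarded r glr (Finset.Iic ℓ)) := by
  have key := fluxDefect_isBigO_bound S 𝒜 tab σs σa hσs Q Δt hΔt εmax hsolv f hf
  have hbd : ∀ ℓ : Fin s, ∃ C : ℝ, 0 < C ∧ ∀ D : SchemeData Nx Nθ Nμ s,
      D.IsRun S 𝒜 tab σs σa Q Δt εmax f → ∀ R ∈ ({D.ρ ℓ, D.ρlr ℓ} : Set (NodalFun Nx)),
        fluxDefect S 𝒜 σs R (D.glr ℓ) ≤ C * D.bound (Finset.Iio ℓ) ∧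
        fluxDefect S 𝒜 σs R (D.gtr ℓ) ≤ C * D.bound (Finset.Iic ℓ) := by
    intro ℓ
    obtain ⟨h1, h2⟩ := key ℓ _ (Or.inl rfl)
    obtain ⟨h3, h4⟩ := key ℓ _ (Or.inr rfl)
    obtain ⟨C1, h1⟩ := Asymptotics.isBigO_top.1 h1
    obtain ⟨C2, h2⟩ := Asymptotics.isBigO_top.1 h2
    obtain ⟨C3, h3⟩ := Asymptotics.isBigO_top.1 h3
    obtain ⟨C4, h4⟩ := Asymptotics.isBigO_top.1 h4
    have hweak : ∀ {C C' v : ℝ} {D : SchemeData Nx Nθ Nμ s} {J : Finset (Fin s)}, 0 < D.ε →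
        ‖v‖ ≤ C * ‖D.bound J‖ → C ≤ C' → v ≤ C' * D.bound J := by
      intro C C' v D J hD h hC
      rw [Real.norm_of_nonneg (D.bound_nonneg hD J)] at h
      exact (le_abs_self v).trans
        (h.trans (mul_le_mul_of_nonneg_right hC (D.bound_nonneg hD J)))
    refine ⟨1 + |C1| + |C2| + |C3| + |C4|, by positivity, ?_⟩
    have a1 := le_abs_self C1
    have a2 := le_abs_self C2
    have a3 := le_abs_self C3
    have a4 := le_abs_self C4
    have b1 := abs_nonneg C1
    have b2 := abs_nonneg C2
    have b3 := abs_nonneg C3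
    have b4 := abs_nonneg C4
    rintro D hD R (rfl | rfl)
    · exact ⟨hweak hD.pos (h1 ⟨D, hD⟩) (by linarith), hweak hD.pos (h2 ⟨D, hD⟩) (by linarith)⟩
    · exact ⟨hweak hD.pos (h3 ⟨D, hD⟩) (by linarith), hweak hD.pos (h4 ⟨D, hD⟩) (by linarith)⟩
  choose C hC0 hC using hbd
  have hle : ∀ ℓ, C ℓ ≤ 1 + ∑ ℓ, C ℓ := fun ℓ =>
    (Finset.single_le_sum (fun j _ => (hC0 j).le) (Finset.mem_univ ℓ)).trans (by linarith)
  refine ⟨1 + ∑ ℓ, C ℓ, add_pos_of_pos_of_nonneg one_pos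
    (Finset.sum_nonneg fun j _ => (hC0 j).le), ?_⟩
  intro ε hε hε' r ρ g ρlr glr gtr hfull hlow htr ℓ R hR
  let D : SchemeData Nx Nθ Nμ s := ⟨ε, r, ρ, g, ρlr, glr, gtr⟩
  have h := hC ℓ D ⟨hε, hε', hfull, hlow, htr⟩ R hR
  exact ⟨h.1.trans (mul_le_mul_of_nonneg_right (hle ℓ) (D.bound_nonneg hε _)),
    h.2.trans (mul_le_mul_of_nonneg_right (hle ℓ) (D.bound_nonneg hε _))⟩
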